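/- Let $(E,H,\mu)$ be an abstract Wiener space: $H$ is a separable real Hilbert space with norm $|\cdot|$, continuously and densely embedded in a Banach space $(E,\|\cdot\|)$, and $\mu$ is a measure on the Borel $\sigma$-algebra $\mathcal B$ of $E$ under which each $l\in E'$ is normally distributed with mean $0$ and variance $|l|^2$, where $E'\subset H'\equiv H\subset E$. For $t>0$ let $\mu_t$ be the image of $\mu$ under $z\mapsto\sqrt t\,z$ and, for $\mathcal B$-measurable $f:E\to[0,\infty]$, $$P_tf(y)=\int_E f(y+w)\,\mu_t(dw),\qquad U_\alpha f=\int_0^\infty e^{-\alpha t}P_tf\,dt\quad(\alpha>0).$$ A $\mathcal B$-measurable $u:E\to[0,\infty]$ is called $\beta$-excessive if $\alpha U_{\beta+\alpha}u\le u$ for all $\alpha>0$ and $\lim_{\alpha\to\infty}\alpha U_{\beta+\alpha}u=u$ pointwise. A compact Lyapunov function is a function that is $\beta$-excessive for some $\beta>0$ and whose level sets $[v\le a]$, $0<a<\infty$, are relatively compact in $E$. A set $A\in\mathcal B$ is invariant if $P_t1_A=1_A$ for all $t>0$. Let $x\in E\setminus H$. Then there is an orthonormal basis $(e_n)_{n\ge1}$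 of $H$ with $e_n\in E'$ that separates the points of $E$ and satisfies $e_n(x)\ge2^{n/2}$ for all $n\ge1$. For every such basis, let $\widetilde P_nz=\sum_{k=1}^ne_k(z)e_k$ for $z\in E$; there is a subsequence $\widetilde Q_n=\widetilde P_{\varphi(n)}$, $n\ge1$ ($1\le\varphi(1)<\varphi(2)<\cdots$), with $\|\mathrm{Id}_H-\widetilde Q_n|_H\|_{\mathcal L(H,E)}\le2^{-n}$ and $\mu(\{z:\|z-\widetilde Q_nz\|>2^{-n}\})\le2^{-n}$ for all $n\ge1$. For every choice of such a basis and of such a subsequence, put $\widetilde Q_0=0$, $$q_x(z)=\Big[\sum_{n\ge0}2^n\|\widetilde Q_{n+1}z-\widetilde Q_nz\|^2+\Big(\sum_{n\ge1}2^{-n/2}|e_n(z)|\Big)^2\Big]^{1/2}\in[0,\infty],\qquad E_x=\{z\in E:q_x(z)<\infty\},$$ $v_0^x=U_1q_x^2$ and $v_z^x(y)=v_0^x(y-z)$ for $y,z\in E$. Then, for every $z\in E$: 1. $v_z^x$ is a compact Lyapunov function; more precisely, it is $1$-excessive and its level sets $[v_z^x\le a]$, $0\le a<\infty$, are compact; 2.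 $[v_z^x<\infty]=E_x+z$; 3. $E_x+z$ is a Borel affine subspace of $E$ and is invariant. -/

import Mathlib

open MeasureTheory ProbabilityTheory Filter Topology
open scoped NNReal ENNReal

noncomputable section

namespace WienerPotential

variable {H E : Type*}
  [NormedAddCommGroup H] [InnerProductSpace ℝ H] [CompleteSpace H]
  [NormedAddCommGroup E] [NormedSpace ℝ E]

/-- `(E, H, μ)` is an abstract Wiener space, where `i : H → E` is the continuous embedding:
`i` is injective with dense range, and every `l ∈ E'` is, under `μ`, normally distributed
with mean zero and variance `|l|²`.  Here `|l|` is the norm of `l` as an element of `H' ≡ H`,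
that is, the norm of the functional `l ∘ i` on `H`. (That `H` is a separable Hilbert space and
`E` a Banach space with its Borel σ-algebra is carried by type classes.) -/
structure IsAbstractWienerSpace [MeasurableSpace E] (i : H →L[ℝ] E) (μ : Measure E) : Prop where
  injective : Function.Injective i
  denseRange : DenseRange i
  gaussian : ∀ l : StrongDual ℝ E, μ.map l = gaussianReal 0 (‖l.comp i‖₊ ^ 2)

/-- The embedding `E' ⊂ H' ≡ H`: `⟪dualToH i l, h⟫ = l (i h)`. -/
def dualToH (i : H →L[ℝ] E) (l : StrongDual ℝ E) : H :=
  (InnerProductSpace.toDual ℝ H).symm (l.comp i)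

/-- The finite rank operator `P̃ₙ z = ∑_{k ≤ n} ⟨eₖ, z⟩ eₖ` from `E` to `H`, built from a sequence
in `E'`; the sequence `e₁, e₂, …` is indexed from `0`, so that `e k` stands for `e_{k+1}`. -/
def proj (i : H →L[ℝ] E) (e : ℕ → StrongDual ℝ E) (n : ℕ) : E →L[ℝ] H :=
  ∑ k ∈ Finset.range n, (e k).smulRight (dualToH i (e k))

/-- The sequence `e` of elements of `E'` is an orthonormal basis of `H`, it separates the
points of `E`, and `⟨eₙ, x⟩ ≥ 2^{n/2}` for all `n ≥ 1` (here `e n` stands for `e_{n+1}`). -/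
structure IsAdaptedBasis (i : H →L[ℝ] E) (x : E) (e : ℕ → StrongDual ℝ E) : Prop where
  orthonormal : Orthonormal ℝ (fun n => dualToH i (e n))
  total : (Submodule.span ℝ (Set.range fun n => dualToH i (e n))).topologicalClosure = ⊤
  separates : ∀ y z : E, (∀ n, e n y = e n z) → y = z
  lower : ∀ n : ℕ, (2 : ℝ) ^ (((n : ℝ) + 1) / 2) ≤ e n x

/-- The subsequence `Qₙ = P_{φ n}`, `n ≥ 1`, of the projections converges fast: in the operator
norm of `L(H, E)` one has `‖Id_H - Qₙ‖ ≤ 2⁻ⁿ`, and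
`μ {z | ‖z - Q̃ₙ z‖ > 2⁻ⁿ} ≤ 2⁻ⁿ`.  The convention `Q̃₀ = 0` is `φ 0 = 0`. -/
structure IsFastSubsequence [MeasurableSpace E] (i : H →L[ℝ] E) (μ : Measure E)
    (e : ℕ → StrongDual ℝ E) (φ : ℕ → ℕ) : Prop where
  zero : φ 0 = 0
  strictMono : StrictMono φ
  opNorm_le : ∀ n, 1 ≤ n → ‖i - i.comp ((proj i e (φ n)).comp i)‖ ≤ (1 / 2 : ℝ) ^ n
  measure_le : ∀ n, 1 ≤ n →
    μ {z : E | (1 / 2 : ℝ) ^ n < ‖z - i (proj i e (φ n) z)‖} ≤ ENNReal.ofReal ((1 / 2 : ℝ) ^ n)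

/-- The extended norm
`q_x z = (∑_{n ≥ 0} 2ⁿ ‖Q̃_{n+1} z - Q̃ₙ z‖² + (∑_{n ≥ 1} 2^{-n/2} |⟨eₙ, z⟩|)²)^{1/2}`. -/
def qNorm (i : H →L[ℝ] E) (e : ℕ → StrongDual ℝ E) (φ : ℕ → ℕ) (z : E) : ℝ≥0∞ :=
  (∑' n : ℕ, ENNReal.ofReal
        ((2 : ℝ) ^ n * ‖i (proj i e (φ (n + 1)) z) - i (proj i e (φ n) z)‖ ^ 2)
    + (∑' n : ℕ, ENNReal.ofReal ((2 : ℝ) ^ (-(((n : ℝ) + 1) / 2)) * |e n z|)) ^ 2) ^ (1 / 2 : ℝ)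

/-- `E_x = [q_x < ∞]`. -/
def finiteSet (i : H →L[ℝ] E) (e : ℕ → StrongDual ℝ E) (φ : ℕ → ℕ) : Set E :=
  {z | qNorm i e φ z < ∞}

variable [MeasurableSpace E]

/-- `μ_t`, the image of `μ` under `z ↦ √t z`. -/
def scaledMeasure (μ : Measure E) (t : ℝ) : Measure E :=
  μ.map (fun z => Real.sqrt t • z)

/-- The Brownian semigroup `P_t f (y) = ∫ f (y + w) μ_t(dw)` on positive numerical functions. -/
def semigroup (μ : Measure E) (t : ℝ) (f : E → ℝ≥0∞) (y : E) : ℝ≥0∞ :=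
  ∫⁻ w, f (y + w) ∂(scaledMeasure μ t)

/-- The resolvent `U_α f = ∫₀^∞ e^{-α t} P_t f dt`. -/
def resolvent (μ : Measure E) (α : ℝ) (f : E → ℝ≥0∞) (y : E) : ℝ≥0∞ :=
  ∫⁻ t in Set.Ioi (0 : ℝ), ENNReal.ofReal (Real.exp (-α * t)) * semigroup μ t f y

/-- `u` is `β`-excessive, i.e. excessive for the resolvent `(U_{β+α})_{α>0}`. -/
structure IsExcessive (μ : Measure E) (β : ℝ) (u : E → ℝ≥0∞) : Prop where
  measurable : Measurable u
  le : ∀ α : ℝ, 0 < α → ∀ y, ENNReal.ofReal α * resolvent μ (β + α) u y ≤ u y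
  tendsto : ∀ y,
    Tendsto (fun α : ℝ => ENNReal.ofReal α * resolvent μ (β + α) u y) atTop (𝓝 (u y))

/-- A compact Lyapunov function: a `β`-excessive function, for the given `β > 0`, all of whose
level sets `[v ≤ a]`, `a > 0` real, are relatively compact. -/
structure IsCompactLyapunov (μ : Measure E) (β : ℝ) (v : E → ℝ≥0∞) : Prop where
  pos : 0 < β
  excessive : IsExcessive μ β v
  relCompact : ∀ a : ℝ≥0, 0 < a → IsCompact (closure {y | v y ≤ a})

/-- The Borel set `A` is invariant: `P_t 1_A = 1_A` for all `t > 0`. -/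
def IsInvariantSet (μ : Measure E) (A : Set E) : Prop :=
  MeasurableSet A ∧ ∀ t : ℝ, 0 < t →
    semigroup μ t (A.indicator fun _ => 1) = A.indicator fun _ => 1

/-- `v_z^x = v_0^x ∘ T_z⁻¹`, where `v_0^x = U_1 q_x²` and `T_z y = y + z`. -/
def lyapunov (i : H →L[ℝ] E) (μ : Measure E) (e : ℕ → StrongDual ℝ E) (φ : ℕ → ℕ) (z : E) :
    E → ℝ≥0∞ :=
  fun y => resolvent μ 1 (fun w => qNorm i e φ w ^ 2) (y - z)

end WienerPotential

end

/-! Write `q²` for the square of `q_x`. All assertions about `v = U_1 q²` follow from four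
properties of `q²`. It is homogeneous of degree two with `q²(y + z) ≤ 2 q²(y) + 2 q²(z)`, it is
lower semicontinuous, its level sets are compact (`isCompact_sqNorm_le`), and it is `μ`-integrable
(`lintegral_sqNorm_lt_top`).

The first property gives `2 q²(y) ≤ q²(y + w) + q²(y - w)`, so by symmetry of `μ` one has `q² ≤ P_t
q²`, hence `q² ≤ v`. Level sets of `v` are then closed subsets of compact sets, and `v = ∞` off
`E_x`. Conversely `P_t q²(y) ≤ 2 q²(y) + 2 t ∫ q² dμ`, which is integrable against `e^{-t} dt` when
`y ∈ E_x`. Invariance holds because `E_x` is a linear subspace of full measure, so Gaussian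
increments do not change the coset of a point. Excessiveness is the resolvent equation for a
potential.

Integrability of `q²` rests on Fernique's theorem in a form with universal constants: the quantile
`2⁻ⁿ` of the remainder `z - Q̃ₙ z` becomes a second moment of order `4⁻ⁿ`, which beats the weight
`2ⁿ`.

For the basis: if `x ∉ H`, evaluation at `x` is unbounded in the norm of `H` on the orthogonal
complement of every finite-dimensional subspace of `E'`, so new orthonormal vectors can take
arbitrarily large values at `x`. For the subsequence: resampling the tail of `z` independently
preserves `μ` and all cylinder sets in the first coordinates, and cylinder sets approximate small
balls; hence the remainders tend to zero in probability. -/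

namespace WienerPotential

/-! ### Characteristic functional, symmetry, scaling and second moments of the Gaussian measure. -/

section Gaussian

variable {H E : Type*}
  [NormedAddCommGroup H] [InnerProductSpace ℝ H]
  [NormedAddCommGroup E] [NormedSpace ℝ E]

section Dual

variable [CompleteSpace H]

theorem inner_dualToH (i : H →L[ℝ] E) (l : StrongDual ℝ E) (h : H) :
    inner ℝ (dualToH i l) h = l (i h) := by
  simp [dualToH]

theorem norm_dualToH (i : H →L[ℝ] E) (l : StrongDual ℝ E) : ‖dualToH i l‖ = ‖l.comp i‖ := by
  simp [dualToH]

theorem dualToH_add (i : H →L[ℝ] E) (l m : StrongDual ℝ E) :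
    dualToH i (l + m) = dualToH i l + dualToH i m := by
  refine ext_inner_right ℝ fun h => ?_
  simp [inner_add_left, inner_dualToH]

theorem dualToH_smul (i : H →L[ℝ] E) (c : ℝ) (l : StrongDual ℝ E) :
    dualToH i (c • l) = c • dualToH i l := by
  refine ext_inner_right ℝ fun h => ?_
  simp [inner_smul_left, inner_dualToH]

/-- The linear embedding `E' → H`. -/
noncomputable def dualToHₗ (i : H →L[ℝ] E) : StrongDual ℝ E →ₗ[ℝ] H where
  toFun := dualToH i
  map_add' := dualToH_add i
  map_smul' := dualToH_smul i

@[simp]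
theorem dualToHₗ_apply (i : H →L[ℝ] E) (l : StrongDual ℝ E) : dualToHₗ i l = dualToH i l := rfl

end Dual

variable [MeasurableSpace E] {i : H →L[ℝ] E} {μ : Measure E}

theorem IsAbstractWienerSpace.isProbabilityMeasure [BorelSpace E]
    (hW : IsAbstractWienerSpace i μ) : IsProbabilityMeasure μ := by
  have h := hW.gaussian 0
  have h2 : IsProbabilityMeasure (μ.map (0 : StrongDual ℝ E)) := by rw [h]; infer_instance
  exact Measure.isProbabilityMeasure_of_map (0 : StrongDual ℝ E)

theorem IsAbstractWienerSpace.isGaussian [BorelSpace E]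
    (hW : IsAbstractWienerSpace i μ) : IsGaussian μ := by
  refine ⟨fun L => ?_⟩
  have h := hW.gaussian L
  have hm : AEMeasurable L μ := by fun_prop
  have h1 : μ[L] = 0 := by
    rw [← integral_map (φ := L) (f := fun y => y) hm (by fun_prop), h, integral_id_gaussianReal]
  have h2 : Var[L; μ] = ‖L.comp i‖ ^ 2 := by
    have := variance_map (X := id) (Y := L) (μ := μ) (by fun_prop) hm
    rw [h, variance_id_gaussianReal] at this
    simpa using this.symm
  rw [h, h1, h2]
  congr 1
  ext
  simp

theorem IsAbstractWienerSpace.integral_dual [BorelSpace E]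
    (hW : IsAbstractWienerSpace i μ) (L : StrongDual ℝ E) : μ[L] = 0 := by
  rw [← integral_map (φ := L) (f := fun y => y) (by fun_prop) (by fun_prop), hW.gaussian L,
    integral_id_gaussianReal]

theorem IsAbstractWienerSpace.charFunDual_eq [BorelSpace E]
    (hW : IsAbstractWienerSpace i μ) (L : StrongDual ℝ E) :
    charFunDual μ L = Complex.exp (-((‖L.comp i‖ ^ 2 : ℝ) : ℂ) / 2) := by
  rw [charFunDual_eq_charFun_map_one, hW.gaussian L, charFun_gaussianReal]
  congr 1
  simp
  ring

/-- If `z` and `w` are independent with law `μ`, then `A z + B w` has the law of `C z` as soon as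
the covariances agree. -/
theorem IsAbstractWienerSpace.map_prod_eq [BorelSpace E] [SecondCountableTopology E]
    [CompleteSpace E]
    (hW : IsAbstractWienerSpace i μ) (A B C : E →L[ℝ] E)
    (h : ∀ l : StrongDual ℝ E, ‖(l.comp A).comp i‖ ^ 2 + ‖(l.comp B).comp i‖ ^ 2
      = ‖(l.comp C).comp i‖ ^ 2) :
    (μ.prod μ).map (fun p => A p.1 + B p.2) = μ.map C := by
  have := hW.isProbabilityMeasure
  have hm : Measurable (fun p : E × E => A p.1 + B p.2) := by fun_prop
  have := Measure.isProbabilityMeasure_map (μ := μ.prod μ) hm.aemeasurable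
  have := Measure.isProbabilityMeasure_map (μ := μ) (f := C) (by fun_prop)
  refine Measure.ext_of_charFunDual (funext fun l => ?_)
  rw [charFunDual_apply, integral_map hm.aemeasurable (by fun_prop), charFunDual_map,
    hW.charFunDual_eq]
  have h1 : ∀ p : E × E, Complex.exp (((l (A p.1 + B p.2) : ℝ) : ℂ) * Complex.I)
      = Complex.exp (((l.comp A p.1 : ℝ) : ℂ) * Complex.I)
        * Complex.exp (((l.comp B p.2 : ℝ) : ℂ) * Complex.I) := by
    intro p
    rw [← Complex.exp_add]
    simp [add_mul]
  simp_rw [h1]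
  rw [integral_prod_mul (fun z => Complex.exp (((l.comp A z : ℝ) : ℂ) * Complex.I))
      (fun z => Complex.exp (((l.comp B z : ℝ) : ℂ) * Complex.I)),
    ← charFunDual_apply, ← charFunDual_apply, hW.charFunDual_eq, hW.charFunDual_eq,
    ← Complex.exp_add, ← h l]
  congr 1
  push_cast
  ring

theorem IsAbstractWienerSpace.map_neg [BorelSpace E] [SecondCountableTopology E]
    [CompleteSpace E] (hW : IsAbstractWienerSpace i μ) : μ.map (fun z => -z) = μ := by
  -- Covariances do not see signs: with the second factor annihilated, the same law is identified
  -- with that of `-z` and with that of `z`.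
  have h1 := hW.map_prod_eq (-ContinuousLinearMap.id ℝ E) 0 (-ContinuousLinearMap.id ℝ E)
    (by intro l; simp)
  have h2 := hW.map_prod_eq (-ContinuousLinearMap.id ℝ E) 0 (ContinuousLinearMap.id ℝ E)
    (by
      intro l
      have : (l.comp (-ContinuousLinearMap.id ℝ E)).comp i = -(l.comp i) := by ext; simp
      rw [this]
      simp)
  rw [h1] at h2
  have h3 : (⇑(ContinuousLinearMap.id ℝ E)) = id := rfl
  rw [h3, Measure.map_id] at h2
  exact h2

/-- `√s z + √t w` has the law of `√(s + t) z`. -/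
theorem IsAbstractWienerSpace.map_sqrt_add [BorelSpace E] [SecondCountableTopology E]
    [CompleteSpace E] (hW : IsAbstractWienerSpace i μ) {s t : ℝ} (hs : 0 ≤ s) (ht : 0 ≤ t) :
    (μ.prod μ).map (fun p => √s • p.1 + √t • p.2) = μ.map (fun z => √(s + t) • z) := by
  refine hW.map_prod_eq (√s • ContinuousLinearMap.id ℝ E) (√t • ContinuousLinearMap.id ℝ E)
    (√(s + t) • ContinuousLinearMap.id ℝ E) fun l => ?_
  have h : ∀ c : ℝ, (l.comp (c • ContinuousLinearMap.id ℝ E)).comp i = c • (l.comp i) := by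
    intro c; ext; simp
  simp only [h, norm_smul, mul_pow, Real.norm_eq_abs, sq_abs, Real.sq_sqrt hs, Real.sq_sqrt ht,
    Real.sq_sqrt (add_nonneg hs ht)]
  ring

/-- A bound of the second moment of a centred Gaussian measure by a quantile, with a constant that
depends neither on the measure nor on the quantile. -/
theorem exists_lintegral_sq_norm_le (E : Type*) [NormedAddCommGroup E] [NormedSpace ℝ E]
    [SecondCountableTopology E] [CompleteSpace E] [MeasurableSpace E] [BorelSpace E] :
    ∃ K : ℝ≥0∞, K ≠ ∞ ∧ ∀ (ν : Measure E) [IsGaussian ν], (∀ L : StrongDual ℝ E, ν[L] = 0) →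
      ∀ a : ℝ, 0 < a → ENNReal.ofReal (3 / 4) ≤ ν {x | ‖x‖ ≤ a} →
      ∫⁻ x, ENNReal.ofReal (‖x‖ ^ 2) ∂ν ≤ K * ENNReal.ofReal (a ^ 2) := by
  -- Fernique's argument needs a level strictly between `1/2` and `1`. Fixing it once makes
  -- `logRatio c` and the series `S` independent of the measure.
  set c : ℝ≥0∞ := ENNReal.ofReal (3 / 4) with hc
  have hc1 : c < 1 := by rw [hc, ENNReal.ofReal_lt_one]; norm_num
  have hc2 : 2⁻¹ < c := by
    rw [hc, ENNReal.lt_ofReal_iff_toReal_lt (by simp)]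
    norm_num
  have hratio : 1 < (c / (1 - c)).toReal := by
    have : 1 - c = ENNReal.ofReal (1 / 4) := by
      rw [hc, ← ENNReal.ofReal_one, ← ENNReal.ofReal_sub _ (by norm_num)]
      norm_num
    rw [this, hc, ENNReal.toReal_div, ENNReal.toReal_ofReal (by norm_num),
      ENNReal.toReal_ofReal (by norm_num)]
    norm_num
  have hl := Fernique.logRatio_pos hc2 hc1
  set S : ℝ≥0∞ := ENNReal.ofReal (Real.exp (Fernique.logRatio c))
    + ∑' n : ℕ, ENNReal.ofReal (Real.exp (-2⁻¹ * Real.log (c / (1 - c)).toReal * 2 ^ n)) with hS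
  have hSfin : S ≠ ∞ := by
    refine (ENNReal.add_lt_top.mpr ⟨ENNReal.ofReal_lt_top, ?_⟩).ne
    refine Summable.tsum_ofReal_lt_top <|
      Real.summable_exp_nat_mul_of_ge ?_ (fun i ↦ mod_cast (Nat.lt_pow_self (by simp)).le)
    exact mul_neg_of_neg_of_pos (by simp) (Real.log_pos hratio)
  refine ⟨ENNReal.ofReal (Fernique.logRatio c)⁻¹ * S, by finiteness, ?_⟩
  intro ν _ hν a ha hca
  have hrot := IsGaussian.map_rotation_eq_self_of_forall_strongDual_eq_zero hν (-(Real.pi / 4))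
  have hmain := lintegral_exp_mul_sq_norm_le_of_map_rotation_eq_self hrot hca hc2
  -- This is `s ≤ exp s` with `s` equal to the Fernique exponent; the factor `a²` comes from
  -- rescaling.
  have hb : ∀ x : E, ENNReal.ofReal (‖x‖ ^ 2) ≤ ENNReal.ofReal ((Fernique.logRatio c)⁻¹ * a ^ 2) *
      ENNReal.ofReal (Real.exp (Fernique.logRatio c * a⁻¹ ^ 2 * ‖x‖ ^ 2)) := by
    intro x
    rw [← ENNReal.ofReal_mul (by positivity)]
    refine ENNReal.ofReal_le_ofReal ?_
    calc ‖x‖ ^ 2 = ((Fernique.logRatio c)⁻¹ * a ^ 2) *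
          (Fernique.logRatio c * a⁻¹ ^ 2 * ‖x‖ ^ 2) := by field_simp
      _ ≤ _ := by
        refine mul_le_mul_of_nonneg_left ?_ (by positivity)
        linarith [Real.add_one_le_exp (Fernique.logRatio c * a⁻¹ ^ 2 * ‖x‖ ^ 2)]
  calc ∫⁻ x, ENNReal.ofReal (‖x‖ ^ 2) ∂ν
      ≤ ∫⁻ x, ENNReal.ofReal ((Fernique.logRatio c)⁻¹ * a ^ 2) *
        ENNReal.ofReal (Real.exp (Fernique.logRatio c * a⁻¹ ^ 2 * ‖x‖ ^ 2)) ∂ν := lintegral_mono hb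
    _ = ENNReal.ofReal ((Fernique.logRatio c)⁻¹ * a ^ 2) *
        ∫⁻ x, ENNReal.ofReal (Real.exp (Fernique.logRatio c * a⁻¹ ^ 2 * ‖x‖ ^ 2)) ∂ν := by
      rw [lintegral_const_mul' _ _ (by simp)]
    _ ≤ ENNReal.ofReal ((Fernique.logRatio c)⁻¹ * a ^ 2) * S := by gcongr
    _ = ENNReal.ofReal (Fernique.logRatio c)⁻¹ * S * ENNReal.ofReal (a ^ 2) := by
      rw [ENNReal.ofReal_mul (by positivity)]
      ring

end Gaussian

/-! ### Construction of an orthonormal basis with large values at `x`. -/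

section AdaptedBasis

variable {H E : Type*}
  [NormedAddCommGroup H] [InnerProductSpace ℝ H] [CompleteSpace H]
  [NormedAddCommGroup E] [NormedSpace ℝ E] {i : H →L[ℝ] E} {x : E}

/-- The dual of a separable normed space contains a sequence separating the points. -/
theorem exists_separating_seq (E : Type*) [NormedAddCommGroup E] [NormedSpace ℝ E]
    [TopologicalSpace.SeparableSpace E] :
    ∃ l : ℕ → StrongDual ℝ E, ∀ y, (∀ n, l n y = 0) → y = 0 := by
  choose l hl1 hl2 using fun n => exists_dual_vector'' ℝ (TopologicalSpace.denseSeq E n)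
  refine ⟨l, fun y hy => ?_⟩
  rw [← norm_le_zero_iff]
  refine le_of_forall_pos_le_add fun ε hε => ?_
  obtain ⟨n, hn⟩ := (TopologicalSpace.denseRange_denseSeq E).exists_dist_lt y (half_pos hε)
  set d := TopologicalSpace.denseSeq E n with hd
  rw [dist_eq_norm] at hn
  have h1 : ‖d‖ ≤ ‖y - d‖ := by
    have h2 : l n (y - d) = -‖d‖ := by rw [map_sub, hy n, hl2 n]; simp [hd]
    calc ‖d‖ = ‖l n (y - d)‖ := by rw [h2]; simp
      _ ≤ 1 * ‖y - d‖ := (l n).le_of_opNorm_le (hl1 n) _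
      _ = _ := one_mul _
  calc ‖y‖ = ‖(y - d) + d‖ := by simp
    _ ≤ ‖y - d‖ + ‖d‖ := norm_add_le _ _
    _ ≤ 0 + ε := by linarith

theorem dualToHₗ_injective (hd : DenseRange i) : Function.Injective (dualToHₗ i) := by
  rw [← LinearMap.ker_eq_bot, LinearMap.ker_eq_bot']
  intro l hl
  have h : ∀ h, l (i h) = 0 := fun h => by
    rw [← inner_dualToH, ← dualToHₗ_apply, hl, inner_zero_left]
  have h2 : (⇑l : E → ℝ) = fun _ => 0 :=
    hd.equalizer l.continuous continuous_const (funext h)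
  ext y
  exact congrFun h2 y

/-- A point of `E` whose evaluation is bounded in the norm of `H` belongs to `H`. -/
theorem mem_range_of_forall_abs_le (hd : DenseRange i) (C : ℝ)
    (hC : ∀ l : StrongDual ℝ E, |l x| ≤ C * ‖dualToH i l‖) : x ∈ Set.range i := by
  let J := LinearEquiv.ofInjective (dualToHₗ i) (dualToHₗ_injective hd)
  let ev : StrongDual ℝ E →ₗ[ℝ] ℝ :=
    { toFun := fun l => l x, map_add' := fun _ _ => rfl, map_smul' := fun _ _ => rfl }
  -- Evaluation at `x`, transported to the image of `E'` in `H`, is bounded there; Hahn–Banach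
  -- extends it to `H` and Riesz represents it by a vector, which is the preimage of `x`.
  let f : StrongDual ℝ (LinearMap.range (dualToHₗ i)) :=
    (ev.comp J.symm.toLinearMap).mkContinuous C (by
      intro k
      obtain ⟨l, rfl⟩ := J.surjective k
      simpa [ev, J] using hC l)
  obtain ⟨g, hg, -⟩ := exists_extension_norm_eq _ f
  refine ⟨(InnerProductSpace.toDual ℝ H).symm g, ?_⟩
  refine (SeparatingDual.eq_iff_forall_dual_eq (R := ℝ)).mpr fun l => ?_
  rw [← inner_dualToH, real_inner_comm, InnerProductSpace.toDual_symm_apply]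
  have h := hg (J l)
  have h2 : f (J l) = l x := by simp [f, ev]
  rw [h2] at h
  exact h

/-- Orthogonal projection in `H` onto the image of `F`. Its value lies in that image, so both
components remain in `E'`, and both bounds are contractivity of projections. -/
theorem exists_decomposition (F : Submodule ℝ (StrongDual ℝ E)) [FiniteDimensional ℝ F]
    (l : StrongDual ℝ E) :
    ∃ f ∈ F, ‖dualToH i f‖ ≤ ‖dualToH i l‖ ∧ ‖dualToH i (l - f)‖ ≤ ‖dualToH i l‖ ∧
      ∀ f' ∈ F, inner ℝ (dualToH i f') (dualToH i (l - f)) = 0 := by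
  let K := F.map (dualToHₗ i)
  obtain ⟨f, hf, hfk⟩ := (K.starProjection_apply_mem (dualToH i l) : _ ∈ F.map (dualToHₗ i))
  have hs : dualToH i (l - f) = dualToH i l - K.starProjection (dualToH i l) := by
    rw [← hfk, ← dualToHₗ_apply, map_sub]; rfl
  refine ⟨f, hf, ?_, ?_, ?_⟩
  · rw [← dualToHₗ_apply, hfk]
    exact K.norm_starProjection_apply_le _
  · rw [hs, ← Submodule.starProjection_orthogonal_val]
    exact Kᗮ.norm_starProjection_apply_le _
  · intro f' hf'
    rw [hs]
    exact Submodule.inner_right_of_mem_orthogonal (K := K) (Submodule.mem_map_of_mem hf')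
      (K.sub_starProjection_mem_orthogonal _)

/-- Otherwise evaluation at `x` is bounded in the norm of `H` on the orthogonal complement of `F`.
It is bounded on `F` by finite dimension, hence on all of `E'`, and then `x ∈ H` by
`mem_range_of_forall_abs_le`. -/
theorem exists_unit_orthogonal_ge (hd : DenseRange i) (hx : x ∉ Set.range i)
    (F : Submodule ℝ (StrongDual ℝ E)) [FiniteDimensional ℝ F] (R : ℝ) :
    ∃ g : StrongDual ℝ E, ‖dualToH i g‖ = 1 ∧
      (∀ f ∈ F, inner ℝ (dualToH i f) (dualToH i g) = 0) ∧ R ≤ g x := by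
  by_contra! hcon
  have hinj := dualToHₗ_injective hd
  have horth : ∀ g : StrongDual ℝ E, (∀ f ∈ F, inner ℝ (dualToH i f) (dualToH i g) = 0) →
      g x ≤ R * ‖dualToH i g‖ := by
    intro g hg
    rcases eq_or_ne (dualToH i g) 0 with h0 | h0
    · have : g = 0 := hinj (by rw [map_zero]; exact h0)
      subst this
      simp [h0]
    · have hpos : 0 < ‖dualToH i g‖ := norm_pos_iff.mpr h0
      have := hcon (‖dualToH i g‖⁻¹ • g)
        (by rw [dualToH_smul, norm_smul, norm_inv, norm_norm, inv_mul_cancel₀ hpos.ne'])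
        (fun f hf => by rw [dualToH_smul, inner_smul_right, hg f hf, mul_zero])
      rw [smul_apply, smul_eq_mul, inv_mul_lt_iff₀ hpos] at this
      linarith
  let JF : F →ₗ[ℝ] H := (dualToHₗ i).domRestrict F
  have hJ : JF.ker = ⊥ := by
    rw [LinearMap.ker_eq_bot']
    intro f hf
    have : dualToHₗ i f = dualToHₗ i 0 := by rw [map_zero]; exact hf
    exact Subtype.ext (hinj this)
  -- On the finite-dimensional `F` the norm of `E'` is dominated by the norm of `H`.
  obtain ⟨K, -, hK⟩ := LinearMap.exists_antilipschitzWith (𝕜 := ℝ) (E := F) (F := H) JF hJ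
  have hKF : ∀ f ∈ F, ‖f‖ ≤ K * ‖dualToH i f‖ := fun f hf => by
    have := hK.le_mul_dist ⟨f, hf⟩ 0
    rw [map_zero, dist_zero_right, Subtype.dist_eq, ZeroMemClass.coe_zero, dist_zero_right] at this
    exact this
  refine hx (mem_range_of_forall_abs_le hd (K * ‖x‖ + |R|) fun l => ?_)
  obtain ⟨f, hf, h1, h2, h3⟩ := exists_decomposition (i := i) F l
  have hg : |(l - f) x| ≤ |R| * ‖dualToH i l‖ := by
    have hb : R * ‖dualToH i (l - f)‖ ≤ |R| * ‖dualToH i l‖ :=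
      mul_le_mul (le_abs_self _) h2 (norm_nonneg _) (abs_nonneg _)
    have e1 := horth (l - f) h3
    have hneg : dualToH i (-(l - f)) = -dualToH i (l - f) := by
      simp only [← dualToHₗ_apply, map_neg]
    have e2 := horth (-(l - f)) (fun f' hf' => by rw [hneg, inner_neg_right, h3 f' hf', neg_zero])
    rw [hneg, norm_neg, neg_apply] at e2
    rw [abs_le]
    constructor <;> linarith
  have hfx : |f x| ≤ K * ‖x‖ * ‖dualToH i l‖ := by
    calc |f x| ≤ ‖f‖ * ‖x‖ := f.le_opNorm x
      _ ≤ (K * ‖dualToH i f‖) * ‖x‖ := by gcongr; exact hKF f hf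
      _ ≤ (K * ‖dualToH i l‖) * ‖x‖ := by gcongr
      _ = _ := by ring
  calc |l x| = |(l - f) x + f x| := by simp
    _ ≤ |(l - f) x| + |f x| := abs_add_le _ _
    _ ≤ _ := by linarith

/-- The two-step extension of a finite orthonormal system: it captures a given element of `E'`
while the two new elements take large values at `x`. -/
theorem exists_orthonormal_pair (hd : DenseRange i) (hx : x ∉ Set.range i)
    (F : Submodule ℝ (StrongDual ℝ E)) [FiniteDimensional ℝ F] (l : StrongDual ℝ E) (R : ℝ) :
    ∃ a b : StrongDual ℝ E, ‖dualToH i a‖ = 1 ∧ ‖dualToH i b‖ = 1 ∧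
      inner ℝ (dualToH i a) (dualToH i b) = 0 ∧
      (∀ f ∈ F, inner ℝ (dualToH i f) (dualToH i a) = 0) ∧
      (∀ f ∈ F, inner ℝ (dualToH i f) (dualToH i b) = 0) ∧
      l ∈ F ⊔ Submodule.span ℝ {a, b} ∧ R ≤ a x ∧ R ≤ b x := by
  -- `f` is the normalised component of `l` orthogonal to `F`; if `l ∈ F`, any unit vector
  -- orthogonal to `F` serves, with `c = 0`.
  obtain ⟨f, hf1, hfF, hlf⟩ : ∃ f : StrongDual ℝ E, ‖dualToH i f‖ = 1 ∧
      (∀ f' ∈ F, inner ℝ (dualToH i f') (dualToH i f) = 0) ∧ ∃ m ∈ F, ∃ c : ℝ, l = m + c • f := by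
    obtain ⟨m, hm, -, -, horth⟩ := exists_decomposition (i := i) F l
    rcases eq_or_ne (dualToH i (l - m)) 0 with h0 | h0
    · obtain ⟨f, h1, h2, -⟩ := exists_unit_orthogonal_ge hd hx F 0
      have : l - m = 0 := dualToHₗ_injective hd (by rw [map_zero]; exact h0)
      exact ⟨f, h1, h2, m, hm, 0, by rw [zero_smul, add_zero]; exact sub_eq_zero.mp this⟩
    · have hpos : 0 < ‖dualToH i (l - m)‖ := norm_pos_iff.mpr h0
      refine ⟨‖dualToH i (l - m)‖⁻¹ • (l - m), ?_, ?_, m, hm, ‖dualToH i (l - m)‖, ?_⟩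
      · rw [dualToH_smul, norm_smul, norm_inv, norm_norm, inv_mul_cancel₀ hpos.ne']
      · intro f' hf'
        rw [dualToH_smul, inner_smul_right, horth f' hf', mul_zero]
      · rw [smul_smul, mul_inv_cancel₀ hpos.ne', one_smul, add_sub_cancel]
  obtain ⟨m, hm, c, rfl⟩ := hlf
  -- The value `f x` is not under control, so `g` is chosen large enough that rotating the pair `(f,
  -- g)` makes both values at least `R`.
  obtain ⟨g, hg1, hgF, hgx⟩ := exists_unit_orthogonal_ge hd hx (F ⊔ Submodule.span ℝ {f})
    (2 * |R| + 2 * |f x|)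
  have hfg : inner ℝ (dualToH i f) (dualToH i g) = 0 :=
    hgF f (Submodule.mem_sup_right (Submodule.mem_span_singleton_self f))
  have hgF' : ∀ f' ∈ F, inner ℝ (dualToH i f') (dualToH i g) = 0 := fun f' hf' =>
    hgF f' (Submodule.mem_sup_left hf')
  have hgf : inner ℝ (dualToH i g) (dualToH i f) = 0 := by rw [real_inner_comm]; exact hfg
  have hff : inner ℝ (dualToH i f) (dualToH i f) = 1 := by
    rw [real_inner_self_eq_norm_sq, hf1, one_pow]
  have hgg : inner ℝ (dualToH i g) (dualToH i g) = 1 := by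
    rw [real_inner_self_eq_norm_sq, hg1, one_pow]
  have hJ : ∀ s t : ℝ, dualToH i (s • f + t • g) = s • dualToH i f + t • dualToH i g := by
    intro s t
    rw [dualToH_add, dualToH_smul, dualToH_smul]
  have hin : ∀ s t s' t' : ℝ, inner ℝ (dualToH i (s • f + t • g)) (dualToH i (s' • f + t' • g))
      = s * s' + t * t' := by
    intro s t s' t'
    rw [hJ, hJ]
    simp only [inner_add_left, inner_add_right, real_inner_smul_left, real_inner_smul_right,
      hfg, hgf, hff, hgg]
    ring
  have hnorm : ∀ s t : ℝ, s * s + t * t = 1 → ‖dualToH i (s • f + t • g)‖ = 1 := by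
    intro s t hst
    have h : ‖dualToH i (s • f + t • g)‖ ^ 2 = 1 := by
      rw [← real_inner_self_eq_norm_sq, hin, hst]
    exact (pow_eq_one_iff_of_nonneg (norm_nonneg _) two_ne_zero).mp h
  have horth : ∀ s t : ℝ, ∀ f' ∈ F, inner ℝ (dualToH i f') (dualToH i (s • f + t • g)) = 0 := by
    intro s t f' hf'
    rw [hJ, inner_add_right, real_inner_smul_right, real_inner_smul_right, hfF f' hf', hgF' f' hf']
    simp
  -- A rational rotation from the 3-4-5 triangle: `g` enters both vectors with a positive
  -- coefficient, and `4/5` and `3/5` times `2|R| + 2|f x|` absorb `R` and the `f x` term.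
  refine ⟨(3 / 5 : ℝ) • f + (4 / 5 : ℝ) • g, (-4 / 5 : ℝ) • f + (3 / 5 : ℝ) • g,
    hnorm _ _ (by norm_num), hnorm _ _ (by norm_num), by rw [hin]; norm_num, horth _ _, horth _ _,
    ?_, ?_, ?_⟩
  · refine Submodule.add_mem_sup hm (Submodule.smul_mem _ _ ?_)
    rw [Submodule.mem_span_pair]
    refine ⟨3 / 5, -4 / 5, ?_⟩
    module
  · simp only [add_apply, smul_apply, smul_eq_mul]
    linarith [le_abs_self R, neg_abs_le (f x), abs_nonneg R, abs_nonneg (f x)]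
  · simp only [add_apply, smul_apply, smul_eq_mul]
    linarith [le_abs_self R, le_abs_self (f x), abs_nonneg R, abs_nonneg (f x)]

/-- Stage `k` adjoins a pair whose span captures the `k`-th functional of a separating sequence, so
the basis separates points. Totality follows: a vector `h` orthogonal to all of it has `i h`
annihilated by every `e n`, so `i h = 0` and `h = 0`. -/
theorem exists_isAdaptedBasis [TopologicalSpace.SeparableSpace E]
    (hinj : Function.Injective i) (hd : DenseRange i) (hx : x ∉ Set.range i) :
    ∃ e : ℕ → StrongDual ℝ E, IsAdaptedBasis i x e := by
  obtain ⟨l, hl⟩ := exists_separating_seq E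
  let S := {F : Submodule ℝ (StrongDual ℝ E) // FiniteDimensional ℝ F}
  have hstep : ∀ (F : S) (k : ℕ), ∃ a b : StrongDual ℝ E, ‖dualToH i a‖ = 1 ∧ ‖dualToH i b‖ = 1 ∧
      inner ℝ (dualToH i a) (dualToH i b) = 0 ∧
      (∀ f ∈ F.1, inner ℝ (dualToH i f) (dualToH i a) = 0) ∧
      (∀ f ∈ F.1, inner ℝ (dualToH i f) (dualToH i b) = 0) ∧
      l k ∈ F.1 ⊔ Submodule.span ℝ {a, b} ∧
      (2 : ℝ) ^ (k + 1) ≤ a x ∧ (2 : ℝ) ^ (k + 1) ≤ b x := fun F k => by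
    have := F.2
    exact exists_orthonormal_pair hd hx F.1 (l k) _
  choose a b ha hb hab haF hbF hlF hax hbx using hstep
  let next : ℕ → S → S := fun k F => ⟨F.1 ⊔ Submodule.span ℝ {a F k, b F k}, by
    have := F.2
    have : FiniteDimensional ℝ (Submodule.span ℝ {a F k, b F k}) :=
      FiniteDimensional.span_of_finite ℝ (Set.toFinite _)
    infer_instance⟩
  let F : ℕ → S := fun n => Nat.rec ⟨⊥, inferInstance⟩ next n
  have hF : ∀ k, (F (k + 1)).1 = (F k).1 ⊔ Submodule.span ℝ {a (F k) k, b (F k) k} := fun k => rfl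
  have hmono : Monotone fun k => (F k).1 :=
    monotone_nat_of_le_succ fun k => by rw [hF]; exact le_sup_left
  let e : ℕ → StrongDual ℝ E := fun n =>
    if n % 2 = 0 then a (F (n / 2)) (n / 2) else b (F (n / 2)) (n / 2)
  have he0 : ∀ k, e (2 * k) = a (F k) k := fun k => by simp [e]
  have he1 : ∀ k, e (2 * k + 1) = b (F k) k := fun k => by
    have h1 : (2 * k + 1) % 2 = 1 := by omega
    have h2 : (2 * k + 1) / 2 = k := by omega
    simp [e, h1, h2]
  have hcases : ∀ n, ∃ k, n = 2 * k ∨ n = 2 * k + 1 := fun n => ⟨n / 2, by omega⟩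
  have hmem : ∀ n k, n < 2 * k → e n ∈ (F k).1 := by
    intro n k hnk
    obtain ⟨j, hj⟩ := hcases n
    have hjk : j + 1 ≤ k := by omega
    refine hmono hjk ?_
    change e n ∈ (F (j + 1)).1
    rw [hF]
    refine Submodule.mem_sup_right (Submodule.subset_span ?_)
    rcases hj with rfl | rfl
    · rw [he0]; simp
    · rw [he1]; simp
  have hFspan : ∀ k, (F k).1 ≤ Submodule.span ℝ (Set.range e) := by
    intro k
    induction k with
    | zero => exact bot_le
    | succ k ih =>
      rw [hF]
      refine sup_le ih (Submodule.span_le.mpr ?_)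
      rintro m (rfl | rfl)
      · exact Submodule.subset_span ⟨2 * k, he0 k⟩
      · exact Submodule.subset_span ⟨2 * k + 1, he1 k⟩
  have hvanish : ∀ y : E, (∀ n, e n y = 0) → y = 0 := by
    intro y hy
    refine hl y fun k => ?_
    have h1 : l k ∈ Submodule.span ℝ (Set.range e) := hFspan (k + 1) (hlF (F k) k)
    generalize l k = m at h1
    induction h1 using Submodule.span_induction with
    | mem m hm => obtain ⟨n, rfl⟩ := hm; exact hy n
    | zero => rfl
    | add m m' _ _ h h' => rw [add_apply, h, h', add_zero]
    | smul c m _ h => rw [smul_apply, h, smul_zero]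
  refine ⟨e, ⟨⟨fun n => ?_, ?_⟩, ?_, ?_, ?_⟩⟩
  · obtain ⟨k, rfl | rfl⟩ := hcases n
    · simp only [he0, ha]
    · simp only [he1, hb]
  · have hlt : ∀ m n, m < n → inner ℝ (dualToH i (e m)) (dualToH i (e n)) = 0 := by
      intro m n hmn
      obtain ⟨k, rfl | rfl⟩ := hcases n
      · rw [he0]
        exact haF _ _ _ (hmem _ _ hmn)
      · rcases (Nat.lt_succ_iff.mp hmn).lt_or_eq with h | rfl
        · rw [he1]
          exact hbF _ _ _ (hmem _ _ h)
        · rw [he0, he1]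
          exact hab _ _
    intro m n hmn
    rcases lt_or_gt_of_ne hmn with h | h
    · exact hlt m n h
    · change inner ℝ (dualToH i (e m)) (dualToH i (e n)) = 0
      rw [real_inner_comm]
      exact hlt n m h
  · rw [Submodule.topologicalClosure_eq_top_iff, Submodule.eq_bot_iff]
    intro h hh
    refine hinj ?_
    rw [map_zero]
    refine hvanish _ fun n => ?_
    rw [← inner_dualToH]
    exact Submodule.inner_right_of_mem_orthogonal
      (Submodule.subset_span (Set.mem_range_self (f := fun n => dualToH i (e n)) n)) hh
  · intro y z hyz
    rw [← sub_eq_zero]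
    exact hvanish _ fun n => by rw [map_sub, hyz n, sub_self]
  · intro n
    -- The exponent `k + 1` bounds `(n + 1) / 2` for both `n = 2k` and `n = 2k + 1`.
    have hp : ∀ k : ℕ, ∀ s : ℝ, s ≤ k + 1 → (2 : ℝ) ^ s ≤ (2 : ℝ) ^ (k + 1) := fun k s hs => by
      rw [← Real.rpow_natCast]
      exact Real.rpow_le_rpow_of_exponent_le (by norm_num) (by push_cast; exact hs)
    obtain ⟨k, rfl | rfl⟩ := hcases n
    · rw [he0]
      exact (hp k _ (by push_cast; linarith)).trans (hax _ _)
    · rw [he1]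
      exact (hp k _ (by push_cast; linarith)).trans (hbx _ _)

end AdaptedBasis

/-! ### Convergence of the projections in probability, and fast subsequences. -/

section Projections

variable {H E : Type*}
  [NormedAddCommGroup H] [InnerProductSpace ℝ H] [CompleteSpace H]
  [NormedAddCommGroup E] [NormedSpace ℝ E] {i : H →L[ℝ] E} {e : ℕ → StrongDual ℝ E}

theorem proj_apply (i : H →L[ℝ] E) (e : ℕ → StrongDual ℝ E) (n : ℕ) (z : E) :
    proj i e n z = ∑ k ∈ Finset.range n, e k z • dualToH i (e k) := by
  simp [proj]

theorem apply_proj_of_lt (he : Orthonormal ℝ fun n => dualToH i (e n)) {k n : ℕ} (hk : k < n)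
    (z : E) : e k (i (proj i e n z)) = e k z := by
  rw [← inner_dualToH, proj_apply]
  exact he.inner_right_sum (fun k => e k z) (Finset.mem_range.mpr hk)

/-- The remainder `z - P̃ₙ z`. -/
noncomputable def remainder (i : H →L[ℝ] E) (e : ℕ → StrongDual ℝ E) (n : ℕ) : E →L[ℝ] E :=
  ContinuousLinearMap.id ℝ E - i.comp (proj i e n)

theorem remainder_apply (i : H →L[ℝ] E) (e : ℕ → StrongDual ℝ E) (n : ℕ) (z : E) :
    remainder i e n z = z - i (proj i e n z) := rfl

/-- Pythagoras: the first functional is represented in the span of the first `n` basis vectors, the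
second by a vector orthogonal to them. -/
theorem norm_sq_comp_proj_add (he : Orthonormal ℝ fun n => dualToH i (e n)) (n : ℕ)
    (l : StrongDual ℝ E) :
    ‖(l.comp (i.comp (proj i e n))).comp i‖ ^ 2 + ‖(l.comp (remainder i e n)).comp i‖ ^ 2
      = ‖l.comp i‖ ^ 2 := by
  set u := dualToH i (l.comp (i.comp (proj i e n))) with hu
  set v := dualToH i (l.comp (remainder i e n)) with hv
  have huv : u + v = dualToH i l := by
    rw [hu, hv, ← dualToH_add]
    congr 1
    ext z
    simp [remainder_apply]
  have hu' : u = ∑ k ∈ Finset.range n, l (i (dualToH i (e k))) • dualToH i (e k) := by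
    refine ext_inner_right ℝ fun h => ?_
    rw [hu, inner_dualToH, sum_inner]
    simp only [ContinuousLinearMap.comp_apply, proj_apply, map_sum, map_smul, smul_eq_mul,
      real_inner_smul_left, inner_dualToH]
    exact Finset.sum_congr rfl fun k _ => mul_comm _ _
  have hev : ∀ k ∈ Finset.range n, inner ℝ (dualToH i (e k)) v = 0 := by
    intro k hk
    have h1 : inner ℝ (dualToH i (e k)) u = l (i (dualToH i (e k))) := by
      rw [hu']
      exact he.inner_right_sum _ hk
    have h2 : inner ℝ (dualToH i (e k)) (u + v) = l (i (dualToH i (e k))) := by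
      rw [huv, real_inner_comm, inner_dualToH]
    rw [inner_add_right, h1] at h2
    linarith
  have horth : inner ℝ u v = 0 := by
    rw [hu', sum_inner]
    refine Finset.sum_eq_zero fun k hk => ?_
    rw [real_inner_smul_left, hev k hk, mul_zero]
  rw [← norm_dualToH, ← norm_dualToH, ← norm_dualToH, ← huv, ← hu, ← hv]
  have := norm_add_sq_eq_norm_sq_add_norm_sq_of_inner_eq_zero u v horth
  nlinarith

variable [MeasurableSpace E] [BorelSpace E] [SecondCountableTopology E] [CompleteSpace E]
  {μ : Measure E}

/-- Projection and remainder are uncorrelated, hence independent, so the remainder may be replaced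
by that of an independent copy. -/
theorem IsAbstractWienerSpace.map_proj_add_remainder (hW : IsAbstractWienerSpace i μ)
    (he : Orthonormal ℝ fun n => dualToH i (e n)) (n : ℕ) :
    (μ.prod μ).map (fun p => i (proj i e n p.1) + remainder i e n p.2) = μ := by
  have h := hW.map_prod_eq (i.comp (proj i e n)) (remainder i e n) (ContinuousLinearMap.id ℝ E)
    (fun l => by rw [norm_sq_comp_proj_add he]; simp)
  have h3 : (⇑(ContinuousLinearMap.id ℝ E)) = id := rfl
  rw [h3, Measure.map_id] at h
  exact h

omit [CompleteSpace H] in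
theorem IsAbstractWienerSpace.map_prod_sub (hW : IsAbstractWienerSpace i μ) (R : E →L[ℝ] E) :
    (μ.prod μ).map (fun p => R p.2 - R p.1) = μ.map (fun z => √2 • R z) := by
  have h := hW.map_prod_eq (-R) R (√2 • R) (fun l => by
    have h1 : (l.comp (-R)).comp i = -((l.comp R).comp i) := by ext; simp
    have h2 : (l.comp (√2 • R)).comp i = √2 • ((l.comp R).comp i) := by ext; simp
    rw [h1, h2, norm_neg, norm_smul, mul_pow, Real.norm_eq_abs, sq_abs, Real.sq_sqrt zero_le_two]
    ring)
  rw [← show (⇑(√2 • R) : E → E) = fun z => √2 • R z from rfl, ← h]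
  congr 1
  funext p
  simp [sub_eq_neg_add]

/-- The measurable sets which depend on finitely many of the coordinates `e`. -/
def cylinderSets (e : ℕ → StrongDual ℝ E) : Set (Set E) :=
  {C | MeasurableSet C ∧ ∃ n, ∀ z z', (∀ k < n, e k z = e k z') → (z ∈ C ↔ z' ∈ C)}

omit [CompleteSpace H] [SecondCountableTopology E] [CompleteSpace E] [BorelSpace E] in
theorem isSetAlgebra_cylinderSets (e : ℕ → StrongDual ℝ E) : IsSetAlgebra (cylinderSets e) where
  empty_mem := ⟨MeasurableSet.empty, 0, by simp⟩
  compl_mem := by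
    rintro C ⟨hC, n, hn⟩
    exact ⟨hC.compl, n, fun z z' h => not_congr (hn z z' h)⟩
  union_mem := by
    rintro C D ⟨hC, n, hn⟩ ⟨hD, m, hm⟩
    exact ⟨hC.union hD, max n m, fun z z' h => or_congr
      (hn z z' fun k hk => h k (lt_max_of_lt_left hk))
      (hm z z' fun k hk => h k (lt_max_of_lt_right hk))⟩

/-- By Lusin–Souslin the injective coordinate map `E → ℝ^ℕ` is a measurable embedding, so the Borel
σ-algebra is pulled back from the coordinates. -/
theorem generateFrom_cylinderSets (hsep : ∀ y z : E, (∀ n, e n y = e n z) → y = z) :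
    ‹MeasurableSpace E› = MeasurableSpace.generateFrom (cylinderSets e) := by
  refine le_antisymm ?_ (MeasurableSpace.generateFrom_le fun C hC => hC.1)
  have hemb : MeasurableEmbedding (fun z n => e n z : E → ℕ → ℝ) :=
    Measurable.measurableEmbedding (measurable_pi_lambda _ fun n => (e n).measurable)
      fun y z h => hsep y z (congrFun h)
  refine hemb.comap_eq.symm.le.trans ?_
  rw [MeasurableSpace.pi, MeasurableSpace.comap_iSup]
  refine iSup_le fun n => ?_
  rw [MeasurableSpace.comap_comp]
  rintro _ ⟨B, hB, rfl⟩
  refine MeasurableSpace.measurableSet_generateFrom ⟨(e n).measurable hB, n + 1, fun z z' h => ?_⟩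
  simp [h n (Nat.lt_succ_self n)]

/-- The projections converge to the identity in probability. -/
theorem IsAbstractWienerSpace.eventually_measure_remainder_le (hW : IsAbstractWienerSpace i μ)
    (he : Orthonormal ℝ fun n => dualToH i (e n))
    (hsep : ∀ y z : E, (∀ n, e n y = e n z) → y = z) {ε : ℝ} (hε : 0 < ε) {δ : ℝ≥0∞}
    (hδ : 0 < δ) :
    ∀ᶠ n in atTop, μ {z | ε < ‖remainder i e n z‖} ≤ δ := by
  have := hW.isProbabilityMeasure
  wlog hδt : δ ≠ ∞ generalizing δ
  · push Not at hδt
    simp [hδt]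
  -- Two points of one such ball are at distance at most `ε`; finitely many balls carry all mass but
  -- `δ / 2`.
  let B : ℕ → Set E := fun k => Metric.closedBall (TopologicalSpace.denseSeq E k) (ε / 2)
  have hBm : ∀ k, MeasurableSet (B k) := fun k => Metric.isClosed_closedBall.measurableSet
  have hBu : ⋃ k, B k = Set.univ := by
    refine Set.eq_univ_of_forall fun z => ?_
    obtain ⟨k, hk⟩ := (TopologicalSpace.denseRange_denseSeq E).exists_dist_lt z (half_pos hε)
    exact Set.mem_iUnion.mpr ⟨k, Metric.mem_closedBall.mpr hk.le⟩
  obtain ⟨N, hN⟩ : ∃ N, μ (⋃ k ∈ Finset.range N, B k)ᶜ ≤ δ / 2 := by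
    have hanti : Antitone fun N => (⋃ k ∈ Finset.range N, B k)ᶜ := by
      intro m n hmn
      refine Set.compl_subset_compl.mpr (Set.biUnion_subset_biUnion_left fun k hk => ?_)
      exact Finset.range_mono hmn hk
    have hint : ⋂ N, (⋃ k ∈ Finset.range N, B k)ᶜ = ∅ := by
      rw [← Set.compl_iUnion, Set.compl_empty_iff, Set.eq_univ_iff_forall]
      intro z
      obtain ⟨k, hk⟩ := Set.mem_iUnion.mp (hBu.symm ▸ Set.mem_univ z)
      exact Set.mem_iUnion.mpr ⟨k + 1, Set.mem_biUnion (by simp) hk⟩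
    have ht := tendsto_measure_iInter_atTop (μ := μ)
      (fun N => (MeasurableSet.compl (Finset.measurableSet_biUnion (Finset.range N)
        fun k _ => hBm k)).nullMeasurableSet) hanti ⟨0, by finiteness⟩
    rw [hint, measure_empty] at ht
    exact ((tendsto_order.mp ht).2 (δ / 2) (ENNReal.half_pos hδ.ne')).exists.imp fun _ h => h.le
  -- Each of the `N` balls costs two approximation errors `η`, in total at most `δ / 2`.
  set η : ℝ≥0∞ := δ / 2 / 2 / (N + 1) with hη
  have hηt : η ≠ ∞ := by rw [hη]; finiteness
  have hη0 : η ≠ 0 := by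
    rw [hη]
    simp [ENNReal.div_eq_zero_iff, hδ.ne']
  have happrox := fun k => (Measure.MeasureDense.of_generateFrom_isSetAlgebra_finite μ
    (isSetAlgebra_cylinderSets e) (generateFrom_cylinderSets hsep)).approx (B k) (hBm k)
      (by finiteness) η.toReal (ENNReal.toReal_pos hη0 hηt)
  rw [ENNReal.ofReal_toReal hηt] at happrox
  choose C hC hBC using happrox
  choose m hm using fun k => (hC k).2
  filter_upwards [eventually_ge_atTop ((Finset.range N).sup m)] with n hn
  have hmn : ∀ k < N, m k ≤ n := fun k hk =>
    (Finset.le_sup (f := m) (Finset.mem_range.mpr hk)).trans hn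
  -- `T` resamples the tail: it preserves `μ`, and `T p` has the same first `n` coordinates as
  -- `p.1`, so both lie in the same cylinder sets `C k`.
  set T : E × E → E := fun p => i (proj i e n p.1) + remainder i e n p.2 with hT
  have hTm : Measurable T := by fun_prop
  have hTμ : (μ.prod μ).map T = μ := hW.map_proj_add_remainder he n
  have hTs : ∀ s : Set E, MeasurableSet s → (μ.prod μ) (T ⁻¹' s) = μ s := fun s hs => by
    rw [← Measure.map_apply hTm hs, hTμ]
  have hfst : ∀ s : Set E, MeasurableSet s → (μ.prod μ) (Prod.fst ⁻¹' s) = μ s := fun s hs => by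
    rw [← Measure.map_apply measurable_fst hs, Measure.map_fst_prod, measure_univ, one_smul]
  have hTC : ∀ k < N, ∀ p, T p ∈ C k ↔ p.1 ∈ C k := fun k hk p => hm k _ _ fun j hj => by
    have hjn : j < n := hj.trans_le (hmn k hk)
    simp only [hT, remainder_apply, map_add, map_sub, apply_proj_of_lt he hjn, sub_self,
      add_zero]
  have hTsub : ∀ p : E × E, T p - p.1 = remainder i e n p.2 - remainder i e n p.1 := fun p => by
    simp only [hT, remainder_apply]
    abel
  -- Off the exceptional events, `T p ∈ B k` forces `T p ∈ C k`, then `p.1 ∈ C k` and `p.1 ∈ B k`.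
  have hsub : {p : E × E | ε < ‖remainder i e n p.2 - remainder i e n p.1‖} ⊆
      T ⁻¹' (⋃ k ∈ Finset.range N, B k)ᶜ ∪
      ⋃ k ∈ Finset.range N, (T ⁻¹' (B k \ C k) ∪ Prod.fst ⁻¹' (C k \ B k)) := by
    intro p hp
    by_contra hcon
    rw [Set.mem_union, not_or, Set.mem_preimage, Set.mem_compl_iff, not_not] at hcon
    obtain ⟨h1, h2⟩ := hcon
    simp only [Set.mem_iUnion, Finset.mem_range, exists_prop] at h1
    obtain ⟨k, hk, hTB⟩ := h1
    have h5 : p.1 ∈ B k := by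
      by_contra hpB
      refine h2 (Set.mem_biUnion (Finset.mem_coe.mpr (Finset.mem_range.mpr hk)) ?_)
      by_cases hpC : p.1 ∈ C k
      · exact Or.inr ⟨hpC, hpB⟩
      · exact Or.inl ⟨hTB, fun h => hpC ((hTC k hk p).mp h)⟩
    have h6 : dist (T p) p.1 ≤ ε := by
      calc dist (T p) p.1 ≤ dist (T p) (TopologicalSpace.denseSeq E k)
            + dist p.1 (TopologicalSpace.denseSeq E k) := dist_triangle_right _ _ _
        _ ≤ ε / 2 + ε / 2 := add_le_add hTB h5
        _ = ε := by ring
    rw [dist_eq_norm, hTsub] at h6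
    exact absurd hp (not_lt.mpr h6)
  have hCm : ∀ k, MeasurableSet (C k) := fun k => (hC k).1
  have hbound : (μ.prod μ) {p : E × E | ε < ‖remainder i e n p.2 - remainder i e n p.1‖} ≤ δ := by
    calc _ ≤ _ := measure_mono hsub
      _ ≤ (μ.prod μ) (T ⁻¹' (⋃ k ∈ Finset.range N, B k)ᶜ) + ∑ k ∈ Finset.range N,
          ((μ.prod μ) (T ⁻¹' (B k \ C k)) + (μ.prod μ) (Prod.fst ⁻¹' (C k \ B k))) := by
        refine (measure_union_le _ _).trans (add_le_add_right ?_ _)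
        refine (measure_biUnion_finset_le _ _).trans (Finset.sum_le_sum fun k _ => ?_)
        exact measure_union_le _ _
      _ ≤ δ / 2 + ∑ k ∈ Finset.range N, (η + η) := by
        rw [hTs _ (Finset.measurableSet_biUnion _ fun k _ => hBm k).compl]
        refine add_le_add hN (Finset.sum_le_sum fun k _ => ?_)
        rw [hTs _ ((hBm k).diff (hCm k)), hfst _ ((hCm k).diff (hBm k))]
        exact add_le_add ((measure_mono Set.subset_union_left).trans (hBC k).le)
          ((measure_mono Set.subset_union_right).trans (hBC k).le)
      _ ≤ δ / 2 + δ / 2 := by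
        gcongr
        rw [Finset.sum_const, Finset.card_range, nsmul_eq_mul, ← two_mul, hη]
        calc (N : ℝ≥0∞) * (2 * (δ / 2 / 2 / (N + 1))) ≤
              (N + 1) * (2 * (δ / 2 / 2 / (N + 1))) := by gcongr; exact le_self_add
          _ = 2 * ((N + 1) * (δ / 2 / 2 / (N + 1))) := by ring
          _ = 2 * (δ / 2 / 2) := by
            rw [ENNReal.mul_div_cancel (by simp) (by finiteness)]
          _ = δ / 2 := ENNReal.mul_div_cancel (by simp) (by simp)
      _ = δ := ENNReal.add_halves δ
  refine le_trans ?_ hbound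
  have hset : MeasurableSet {y : E | ε < ‖y‖} := measurableSet_lt measurable_const measurable_norm
  -- Desymmetrisation: the difference of two independent remainders is distributed as `√2` times one
  -- of them, and `√2 ≥ 1`.
  have h1 : (μ.prod μ) {p : E × E | ε < ‖remainder i e n p.2 - remainder i e n p.1‖}
      = μ {z | ε < ‖√2 • remainder i e n z‖} := by
    have h2 := congrArg (fun ν => ν {y : E | ε < ‖y‖}) (hW.map_prod_sub (remainder i e n))
    rw [Measure.map_apply (by fun_prop) hset, Measure.map_apply (by fun_prop) hset] at h2
    exact h2
  rw [h1]
  refine measure_mono fun z (hz : ε < _) => hz.trans_le ?_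
  rw [norm_smul, Real.norm_eq_abs, abs_of_nonneg (Real.sqrt_nonneg 2)]
  exact le_mul_of_one_le_left (norm_nonneg _) (Real.one_le_sqrt.mpr one_le_two)

theorem gaussianReal_one_lt_abs_pos : 0 < gaussianReal 0 1 {x : ℝ | 1 < |x|} := by
  rw [pos_iff_ne_zero]
  intro h
  have h2 : volume {x : ℝ | 1 < |x|} = 0 :=
    gaussianReal_absolutelyContinuous' 0 one_ne_zero h
  have h3 : IsOpen {x : ℝ | 1 < |x|} := isOpen_lt continuous_const continuous_abs
  exact (h3.measure_pos volume ⟨2, by norm_num⟩).ne' h2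

theorem gaussianReal_lt_abs {σ : ℝ≥0} (hσ : 0 < σ) :
    gaussianReal 0 (σ ^ 2) {x : ℝ | σ < |x|} = gaussianReal 0 1 {x : ℝ | 1 < |x|} := by
  have h := gaussianReal_map_const_mul (μ := 0) (v := 1) (σ : ℝ)
  have hv : (NNReal.mk ((σ : ℝ) ^ 2) (sq_nonneg _)) * 1 = σ ^ 2 := by rw [mul_one]; rfl
  rw [hv, mul_zero] at h
  rw [← h, Measure.map_apply (by fun_prop) (measurableSet_lt (by fun_prop) (by fun_prop))]
  congr 1
  ext x
  have : (0 : ℝ) < σ := hσ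
  simp [abs_mul, this]

omit [CompleteSpace H] [SecondCountableTopology E] [CompleteSpace E] in
/-- A quantile of `‖R z‖` controls the operator norm of `R` on `H`. -/
theorem IsAbstractWienerSpace.opNorm_comp_le (hW : IsAbstractWienerSpace i μ) (R : E →L[ℝ] E)
    {ε : ℝ} (hε : 0 < ε) (h : μ {z | ε < ‖R z‖} < gaussianReal 0 1 {x : ℝ | 1 < |x|}) :
    ‖R.comp i‖ ≤ ε := by
  have key : ∀ l : StrongDual ℝ E, ‖l‖ ≤ 1 → ‖(l.comp R).comp i‖ ≤ ε := by
    intro l hl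
    by_contra! hlt
    -- `l ∘ R` is centred Gaussian with standard deviation above `ε`, and it exceeds its own
    -- standard deviation with a probability that does not depend on `l`.
    refine absurd h (not_lt.mpr ?_)
    rw [← gaussianReal_lt_abs (σ := ‖(l.comp R).comp i‖₊) (hε.trans hlt), ← hW.gaussian,
      Measure.map_apply (by fun_prop) (measurableSet_lt (by fun_prop) (by fun_prop))]
    refine measure_mono fun z hz => ?_
    calc ε < ‖(l.comp R).comp i‖ := hlt
      _ ≤ ‖l (R z)‖ := (le_of_lt hz)
      _ ≤ 1 * ‖R z‖ := l.le_of_opNorm_le hl _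
      _ = ‖R z‖ := one_mul _
  refine ContinuousLinearMap.opNorm_le_bound _ hε.le fun h => ?_
  obtain ⟨l, hl, hl2⟩ := exists_dual_vector'' ℝ (R (i h))
  calc ‖R (i h)‖ = ‖((l.comp R).comp i) h‖ := by simp [hl2]
    _ ≤ ε * ‖h‖ := ContinuousLinearMap.le_of_opNorm_le _ (key l hl) h

/-- Convergence in probability suffices for both bounds, since `opNorm_comp_le` turns a small enough
tail probability into an operator norm estimate. -/
theorem IsAbstractWienerSpace.exists_isFastSubsequence (hW : IsAbstractWienerSpace i μ)
    (he : Orthonormal ℝ fun n => dualToH i (e n))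
    (hsep : ∀ y z : E, (∀ n, e n y = e n z) → y = z) :
    ∃ φ : ℕ → ℕ, IsFastSubsequence i μ e φ := by
  have hex : ∀ n : ℕ, ∃ N, ∀ m ≥ N, ‖(remainder i e m).comp i‖ ≤ (1 / 2 : ℝ) ^ n ∧
      μ {z | (1 / 2 : ℝ) ^ n < ‖remainder i e m z‖} ≤ ENNReal.ofReal ((1 / 2 : ℝ) ^ n) := by
    intro n
    have hpos : (0 : ℝ) < (1 / 2) ^ n := by positivity
    obtain ⟨c, hc0, hc⟩ := exists_between gaussianReal_one_lt_abs_pos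
    have h1 := hW.eventually_measure_remainder_le he hsep hpos hc0
    have h2 := hW.eventually_measure_remainder_le he hsep hpos (ENNReal.ofReal_pos.mpr hpos)
    obtain ⟨N, hN⟩ := eventually_atTop.mp (h1.and h2)
    exact ⟨N, fun m hm => ⟨hW.opNorm_comp_le _ hpos ((hN m hm).1.trans_lt hc), (hN m hm).2⟩⟩
  choose N hN using hex
  let φ : ℕ → ℕ := fun n => Nat.rec 0 (fun k p => max (N (k + 1)) (p + 1)) n
  have hφ : ∀ k, φ (k + 1) = max (N (k + 1)) (φ k + 1) := fun k => rfl
  have hφN : ∀ n, 1 ≤ n → N n ≤ φ n := by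
    intro n hn
    obtain ⟨k, rfl⟩ := Nat.exists_eq_add_of_le' hn
    rw [hφ]
    exact le_max_left _ _
  refine ⟨φ, rfl, strictMono_nat_of_lt_succ fun k => ?_, fun n hn => ?_, fun n hn => ?_⟩
  · rw [hφ]
    exact lt_max_of_lt_right (Nat.lt_succ_self _)
  · exact (hN n _ (hφN n hn)).1
  · exact (hN n _ (hφN n hn)).2

end Projections

/-! ### The functional `q²`: subadditivity up to a factor, compact level sets, integrability. -/

theorem ennreal_add_sq_le (a b : ℝ≥0∞) : (a + b) ^ 2 ≤ 2 * a ^ 2 + 2 * b ^ 2 := by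
  have h := ENNReal.rpow_add_le_mul_rpow_add_rpow a b (p := 2) (by norm_num)
  have h2 : (2 : ℝ≥0∞) ^ ((2 : ℝ) - 1) = 2 := by norm_num
  rw [h2, mul_add] at h
  exact_mod_cast h

section SqNorm

variable {H E : Type*}
  [NormedAddCommGroup H] [InnerProductSpace ℝ H] [CompleteSpace H]
  [NormedAddCommGroup E] [NormedSpace ℝ E] {i : H →L[ℝ] E} {e : ℕ → StrongDual ℝ E} {φ : ℕ → ℕ}

/-- The increment `Q̃ₙ₊₁ - Q̃ₙ`. -/
noncomputable def increment (i : H →L[ℝ] E) (e : ℕ → StrongDual ℝ E) (φ : ℕ → ℕ) (n : ℕ) :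
    E →L[ℝ] E :=
  i.comp (proj i e (φ (n + 1))) - i.comp (proj i e (φ n))

/-- The weights `2^{-n/2}`, indexed from `0`. -/
noncomputable def weight (n : ℕ) : ℝ := (2 : ℝ) ^ (-(((n : ℝ) + 1) / 2))

theorem weight_pos (n : ℕ) : 0 < weight n := Real.rpow_pos_of_pos two_pos _

theorem tsum_weight_ne_top : ∑' n, ENNReal.ofReal (weight n) ≠ ∞ := by
  refine Summable.tsum_ofReal_ne_top ?_
  have h : weight = fun n : ℕ => ((2 : ℝ) ^ (-(1 / 2) : ℝ)) ^ n * (2 : ℝ) ^ (-(1 / 2) : ℝ) := by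
    funext n
    rw [weight, ← pow_succ, ← Real.rpow_natCast, ← Real.rpow_mul two_pos.le]
    congr 1
    push_cast
    ring
  rw [h]
  refine (summable_geometric_of_lt_one (by positivity) ?_).mul_right _
  exact Real.rpow_lt_one_of_one_lt_of_neg one_lt_two (by norm_num)

/-- The weighted `ℓ¹` norm of the coordinates. -/
noncomputable def coordNorm (e : ℕ → StrongDual ℝ E) (z : E) : ℝ≥0∞ :=
  ∑' n : ℕ, ENNReal.ofReal (weight n * |e n z|)

/-- The weighted quadratic variation along the subsequence. -/
noncomputable def sqVariation (i : H →L[ℝ] E) (e : ℕ → StrongDual ℝ E) (φ : ℕ → ℕ) (z : E) :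
    ℝ≥0∞ :=
  ∑' n : ℕ, ENNReal.ofReal ((2 : ℝ) ^ n * ‖increment i e φ n z‖ ^ 2)

/-- The square of `q_x`. -/
noncomputable def sqNorm (i : H →L[ℝ] E) (e : ℕ → StrongDual ℝ E) (φ : ℕ → ℕ) (z : E) : ℝ≥0∞ :=
  sqVariation i e φ z + coordNorm e z ^ 2

theorem qNorm_eq (i : H →L[ℝ] E) (e : ℕ → StrongDual ℝ E) (φ : ℕ → ℕ) (z : E) :
    qNorm i e φ z = sqNorm i e φ z ^ (1 / 2 : ℝ) := rfl

theorem qNorm_sq (i : H →L[ℝ] E) (e : ℕ → StrongDual ℝ E) (φ : ℕ → ℕ) (z : E) :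
    qNorm i e φ z ^ 2 = sqNorm i e φ z := by
  rw [qNorm_eq, ← ENNReal.rpow_natCast, ← ENNReal.rpow_mul]
  norm_num

theorem mem_finiteSet {z : E} : z ∈ finiteSet i e φ ↔ sqNorm i e φ z < ∞ := by
  rw [finiteSet, Set.mem_ofPred_eq, qNorm_eq, ENNReal.rpow_lt_top_iff_of_pos (by norm_num)]

theorem sqVariation_smul (c : ℝ) (z : E) :
    sqVariation i e φ (c • z) = ENNReal.ofReal (c ^ 2) * sqVariation i e φ z := by
  rw [sqVariation, sqVariation, ← ENNReal.tsum_mul_left]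
  refine tsum_congr fun n => ?_
  rw [← ENNReal.ofReal_mul (sq_nonneg c), map_smul, norm_smul, mul_pow, Real.norm_eq_abs, sq_abs]
  congr 1
  ring

omit [CompleteSpace H] in
theorem coordNorm_smul (c : ℝ) (z : E) :
    coordNorm e (c • z) = ENNReal.ofReal |c| * coordNorm e z := by
  rw [coordNorm, coordNorm, ← ENNReal.tsum_mul_left]
  refine tsum_congr fun n => ?_
  rw [← ENNReal.ofReal_mul (abs_nonneg c), map_smul, smul_eq_mul, abs_mul]
  congr 1
  ring

theorem sqNorm_smul (c : ℝ) (z : E) :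
    sqNorm i e φ (c • z) = ENNReal.ofReal (c ^ 2) * sqNorm i e φ z := by
  rw [sqNorm, sqNorm, sqVariation_smul, coordNorm_smul, mul_add, mul_pow,
    ← ENNReal.ofReal_pow (abs_nonneg c), sq_abs]

theorem ofReal_mul_norm_add_sq_le {F : Type*} [SeminormedAddCommGroup F] {c : ℝ} (hc : 0 ≤ c)
    (a b : F) : ENNReal.ofReal (c * ‖a + b‖ ^ 2) ≤
      2 * ENNReal.ofReal (c * ‖a‖ ^ 2) + 2 * ENNReal.ofReal (c * ‖b‖ ^ 2) := by
  have h2 : (2 : ℝ≥0∞) = ENNReal.ofReal 2 := by simp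
  rw [h2, ← ENNReal.ofReal_mul zero_le_two, ← ENNReal.ofReal_mul zero_le_two,
    ← ENNReal.ofReal_add (by positivity) (by positivity)]
  refine ENNReal.ofReal_le_ofReal ?_
  have h : ‖a + b‖ ^ 2 ≤ 2 * ‖a‖ ^ 2 + 2 * ‖b‖ ^ 2 := by
    nlinarith [norm_add_le a b, norm_nonneg (a + b), sq_nonneg (‖a‖ - ‖b‖)]
  nlinarith [mul_le_mul_of_nonneg_left h hc]

theorem sqVariation_add_le (y z : E) :
    sqVariation i e φ (y + z) ≤ 2 * sqVariation i e φ y + 2 * sqVariation i e φ z := by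
  rw [sqVariation, sqVariation, sqVariation, ← ENNReal.tsum_mul_left, ← ENNReal.tsum_mul_left,
    ← ENNReal.tsum_add]
  refine ENNReal.tsum_le_tsum fun n => ?_
  rw [map_add]
  exact ofReal_mul_norm_add_sq_le (by positivity) _ _

omit [CompleteSpace H] in
theorem coordNorm_add_le (y z : E) : coordNorm e (y + z) ≤ coordNorm e y + coordNorm e z := by
  rw [coordNorm, coordNorm, coordNorm, ← ENNReal.tsum_add]
  refine ENNReal.tsum_le_tsum fun n => ?_
  have hw := (weight_pos n).le
  rw [← ENNReal.ofReal_add (by positivity) (by positivity), ← mul_add, map_add]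
  gcongr
  exact abs_add_le _ _

theorem sqNorm_add_le (y z : E) :
    sqNorm i e φ (y + z) ≤ 2 * sqNorm i e φ y + 2 * sqNorm i e φ z := by
  have h := (pow_le_pow_left₀ bot_le (coordNorm_add_le (e := e) y z) 2).trans
    (ennreal_add_sq_le _ _)
  refine (add_le_add (sqVariation_add_le y z) h).trans_eq ?_
  rw [sqNorm, sqNorm]
  ring

theorem lowerSemicontinuous_sqNorm : LowerSemicontinuous (sqNorm i e φ) := by
  refine LowerSemicontinuous.add ?_ ?_
  · refine lowerSemicontinuous_tsum fun n => Continuous.lowerSemicontinuous ?_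
    exact ENNReal.continuous_ofReal.comp (by fun_prop)
  · refine Continuous.comp_lowerSemicontinuous (g := fun a : ℝ≥0∞ => a ^ 2)
      (ENNReal.continuous_pow 2) (lowerSemicontinuous_tsum fun n => Continuous.lowerSemicontinuous ?_)
      fun a b h => pow_le_pow_left₀ bot_le h 2
    exact ENNReal.continuous_ofReal.comp (by fun_prop)

/-- The subspace `E_x`. -/
noncomputable def finiteSubmodule (i : H →L[ℝ] E) (e : ℕ → StrongDual ℝ E) (φ : ℕ → ℕ) :
    Submodule ℝ E where
  carrier := finiteSet i e φ
  zero_mem' := by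
    rw [mem_finiteSet]
    have h := sqNorm_smul (i := i) (e := e) (φ := φ) 0 0
    simp only [smul_zero, ne_eq, OfNat.ofNat_ne_zero, not_false_eq_true, zero_pow,
      ENNReal.ofReal_zero, zero_mul] at h
    simp [h]
  add_mem' := by
    intro y z hy hz
    rw [mem_finiteSet] at *
    exact (sqNorm_add_le y z).trans_lt (by finiteness)
  smul_mem' := by
    intro c z hz
    rw [mem_finiteSet] at *
    rw [sqNorm_smul]
    finiteness

theorem mem_finiteSubmodule {z : E} : z ∈ finiteSubmodule i e φ ↔ sqNorm i e φ z < ∞ :=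
  mem_finiteSet

/-- On a level set `Q̃ₙ z → z` uniformly at a geometric rate, while each `Q̃ₙ` maps the level set
into a compact finite-dimensional box. This gives total boundedness; closedness is lower
semicontinuity. -/
theorem isCompact_sqNorm_le [CompleteSpace E] (he : Orthonormal ℝ fun n => dualToH i (e n))
    (hsep : ∀ y z : E, (∀ n, e n y = e n z) → y = z) (hφ : StrictMono φ) (a : ℝ≥0) :
    IsCompact {z | sqNorm i e φ z ≤ a} := by
  have hclosed : IsClosed {z | sqNorm i e φ z ≤ a} :=
    lowerSemicontinuous_sqNorm.isClosed_preimage _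
  refine TotallyBounded.isCompact_of_isClosed ?_ hclosed
  have hcoord : ∀ z, sqNorm i e φ z ≤ a → ∀ k, |e k z| ≤ √a / weight k := by
    intro z hz k
    have h1 : ENNReal.ofReal (weight k * |e k z|) ^ 2 ≤ ENNReal.ofReal a := by
      rw [ENNReal.ofReal_coe_nnreal]
      refine le_trans ?_ (le_trans le_add_self hz)
      exact pow_le_pow_left₀ bot_le (ENNReal.le_tsum k) 2
    have hw := weight_pos k
    rw [← ENNReal.ofReal_pow (by positivity), ENNReal.ofReal_le_ofReal_iff a.coe_nonneg] at h1
    rw [le_div_iff₀ hw, mul_comm]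
    exact Real.le_sqrt_of_sq_le h1
  have hincr : ∀ z, sqNorm i e φ z ≤ a → ∀ n, ‖increment i e φ n z‖ ≤ √a * √(1 / 2) ^ n := by
    intro z hz n
    have h1 : ENNReal.ofReal ((2 : ℝ) ^ n * ‖increment i e φ n z‖ ^ 2) ≤ ENNReal.ofReal a := by
      rw [ENNReal.ofReal_coe_nnreal]
      refine le_trans ?_ (le_trans le_self_add hz)
      exact ENNReal.le_tsum n
    rw [ENNReal.ofReal_le_ofReal_iff a.coe_nonneg] at h1
    refine le_of_sq_le_sq ?_ (by positivity)
    rw [mul_pow, Real.sq_sqrt a.coe_nonneg, ← pow_mul, mul_comm n 2, pow_mul, Real.sq_sqrt (by norm_num)]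
    have h2 : (2 : ℝ) ^ n * (1 / 2) ^ n = 1 := by rw [← mul_pow]; norm_num
    have h3 : (0 : ℝ) ≤ (1 / 2) ^ n := by positivity
    calc ‖increment i e φ n z‖ ^ 2 = ((2 : ℝ) ^ n * (1 / 2) ^ n) * ‖increment i e φ n z‖ ^ 2 := by
          rw [h2, one_mul]
      _ = (2 : ℝ) ^ n * ‖increment i e φ n z‖ ^ 2 * (1 / 2) ^ n := by ring
      _ ≤ a * (1 / 2) ^ n := by gcongr
  have hr : √(1 / 2 : ℝ) < 1 := by
    rw [Real.sqrt_lt' one_pos]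
    norm_num
  have hdist : ∀ z, sqNorm i e φ z ≤ a → ∀ n,
      dist (i (proj i e (φ n) z)) z ≤ √a * √(1 / 2) ^ n / (1 - √(1 / 2)) := by
    intro z hz n
    have hstep : ∀ n, dist (i (proj i e (φ n) z)) (i (proj i e (φ (n + 1)) z))
        ≤ √a * √(1 / 2) ^ n := fun n => by
      rw [dist_comm, dist_eq_norm]
      exact hincr z hz n
    obtain ⟨y, hy⟩ := cauchySeq_tendsto_of_complete (cauchySeq_of_le_geometric _ _ hr hstep)
    -- `Q̃ₙ z` has the same `k`-th coordinate as `z` once `φ n > k`, so the limit has all the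
    -- coordinates of `z`.
    have hyz : y = z := by
      refine hsep _ _ fun k => ?_
      have h1 : Tendsto (fun n => e k (i (proj i e (φ n) z))) atTop (𝓝 (e k y)) :=
        ((e k).continuous.tendsto y).comp hy
      refine tendsto_nhds_unique h1 (tendsto_const_nhds.congr' ?_)
      filter_upwards [eventually_gt_atTop k] with n hn
      exact (apply_proj_of_lt he (hn.trans_le (hφ.id_le n)) z).symm
    rw [hyz] at hy
    exact dist_le_of_le_geometric_of_tendsto _ _ hr hstep hy n
  rw [Metric.totallyBounded_iff]
  intro ε hε
  obtain ⟨n, hn⟩ : ∃ n, √a * √(1 / 2) ^ n / (1 - √(1 / 2)) < ε / 2 := by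
    have h1 : Tendsto (fun n : ℕ => √a * √(1 / 2) ^ n / (1 - √(1 / 2))) atTop
        (𝓝 (√a * 0 / (1 - √(1 / 2)))) :=
      ((tendsto_pow_atTop_nhds_zero_of_lt_one (Real.sqrt_nonneg _) hr).const_mul _).div_const _
    rw [mul_zero, zero_div] at h1
    exact ((tendsto_order.mp h1).2 _ (half_pos hε)).exists
  -- `G` reads only finitely many coordinates, but is defined on all sequences so that the box is
  -- compact by Tychonoff.
  let G : (ℕ → ℝ) → E := fun c => i (∑ k ∈ Finset.range (φ n), c k • dualToH i (e k))
  have hG : Continuous G := by fun_prop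
  have hbox : IsCompact (G '' Set.univ.pi fun k => Set.Icc (-(√a / weight k)) (√a / weight k)) :=
    (isCompact_univ_pi fun k => isCompact_Icc).image hG
  obtain ⟨t, ht, htc⟩ := Metric.totallyBounded_iff.mp hbox.totallyBounded (ε / 2) (half_pos hε)
  refine ⟨t, ht, fun z hz => ?_⟩
  have hmem : i (proj i e (φ n) z) ∈
      G '' Set.univ.pi fun k => Set.Icc (-(√a / weight k)) (√a / weight k) :=
    ⟨fun k => e k z, fun k _ => abs_le.mp (hcoord z hz k), by rw [proj_apply]⟩
  obtain ⟨y, hy, hyd⟩ := Set.mem_iUnion₂.mp (htc hmem)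
  refine Set.mem_iUnion₂.mpr ⟨y, hy, ?_⟩
  rw [Metric.mem_ball] at hyd ⊢
  calc dist z y ≤ dist z (i (proj i e (φ n) z)) + dist (i (proj i e (φ n) z)) y :=
        dist_triangle _ _ _
    _ < ε / 2 + ε / 2 := by
      refine add_lt_add ?_ hyd
      rw [dist_comm]
      exact (hdist z hz n).trans_lt hn
    _ = ε := add_halves ε

variable [MeasurableSpace E] [BorelSpace E] [SecondCountableTopology E] [CompleteSpace E]
  {μ : Measure E}

omit [CompleteSpace H] in
theorem IsAbstractWienerSpace.lintegral_sq_norm_lt_top (hW : IsAbstractWienerSpace i μ)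
    (R : E →L[ℝ] E) : ∫⁻ z, ENNReal.ofReal (‖R z‖ ^ 2) ∂μ < ∞ := by
  have := hW.isGaussian
  have h1 : MemLp id 2 μ := IsGaussian.memLp_id μ 2 (by simp)
  have h2 : MemLp (fun z => R z) 2 μ := R.comp_memLp' h1
  exact (h2.integrable_norm_pow two_ne_zero).lintegral_lt_top

/-- For `n ≥ 2` the ball of radius `2⁻ⁿ` carries mass at least `1 - 2⁻ⁿ ≥ 3/4`, the level required
by the universal Fernique bound. -/
theorem IsFastSubsequence.exists_lintegral_remainder_le (hφ : IsFastSubsequence i μ e φ)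
    (hW : IsAbstractWienerSpace i μ) :
    ∃ K : ℝ≥0∞, K ≠ ∞ ∧ ∀ n, ∫⁻ z, ENNReal.ofReal (‖remainder i e (φ n) z‖ ^ 2) ∂μ
      ≤ K * ENNReal.ofReal ((1 / 4) ^ n) := by
  have := hW.isProbabilityMeasure
  have := hW.isGaussian
  obtain ⟨K, hK, hKν⟩ := exists_lintegral_sq_norm_le E
  set m : ℕ → ℝ≥0∞ := fun n => ∫⁻ z, ENNReal.ofReal (‖remainder i e (φ n) z‖ ^ 2) ∂μ with hm
  have hmt : ∀ n, m n ≠ ∞ := fun n => (hW.lintegral_sq_norm_lt_top _).ne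
  -- The terms `m 0` and `4 * m 1` absorb the cases `n = 0` and `n = 1`, where the quantile level is
  -- too low.
  refine ⟨K + m 0 + 4 * m 1, by finiteness [hmt 0, hmt 1], fun n => ?_⟩
  change m n ≤ _
  match n with
  | 0 =>
    rw [pow_zero, ENNReal.ofReal_one, mul_one]
    exact le_add_right le_add_self
  | 1 =>
    have h4 : (4 : ℝ≥0∞) * ENNReal.ofReal ((1 / 4) ^ 1) = 1 := by
      rw [show (4 : ℝ≥0∞) = ENNReal.ofReal 4 by simp, ← ENNReal.ofReal_mul (by norm_num)]
      norm_num
    calc m 1 = 4 * m 1 * ENNReal.ofReal ((1 / 4) ^ 1) := by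
          rw [mul_comm (4 : ℝ≥0∞), mul_assoc, h4, mul_one]
      _ ≤ _ := by gcongr; exact le_add_self
  | n + 2 =>
    set R := remainder i e (φ (n + 2)) with hR
    have hRm : Measurable R := R.measurable
    have hpow : (1 / 2 : ℝ) ^ (n + 2) ≤ 1 / 4 := by
      calc (1 / 2 : ℝ) ^ (n + 2) ≤ (1 / 2) ^ 2 :=
            pow_le_pow_of_le_one (by norm_num) (by norm_num) (by omega)
        _ = 1 / 4 := by norm_num
    have hq : ENNReal.ofReal (3 / 4) ≤ μ.map R {x | ‖x‖ ≤ (1 / 2) ^ (n + 2)} := by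
      have hset : MeasurableSet {x : E | ‖x‖ ≤ (1 / 2) ^ (n + 2)} :=
        measurableSet_le measurable_norm measurable_const
      rw [Measure.map_apply hRm hset]
      have h1 : R ⁻¹' {x : E | ‖x‖ ≤ (1 / 2) ^ (n + 2)}
          = {z | (1 / 2 : ℝ) ^ (n + 2) < ‖z - i (proj i e (φ (n + 2)) z)‖}ᶜ := by
        ext z
        simp [hR, remainder_apply]
      have hset2 : MeasurableSet {z | (1 / 2 : ℝ) ^ (n + 2) < ‖z - i (proj i e (φ (n + 2)) z)‖} :=
        measurableSet_lt measurable_const (by fun_prop)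
      rw [h1, prob_compl_eq_one_sub hset2]
      calc ENNReal.ofReal (3 / 4) = 1 - ENNReal.ofReal (1 / 4) := by
            rw [← ENNReal.ofReal_one, ← ENNReal.ofReal_sub _ (by norm_num)]
            norm_num
        _ ≤ 1 - ENNReal.ofReal ((1 / 2) ^ (n + 2)) := by gcongr
        _ ≤ _ := tsub_le_tsub_left (hφ.measure_le (n + 2) (by omega)) 1
    have h2 := hKν (μ.map R) (fun L => by
      rw [integral_map hRm.aemeasurable (by fun_prop)]
      exact hW.integral_dual (L.comp R)) _ (by positivity) hq
    rw [lintegral_map (by fun_prop) hRm, ← pow_mul, mul_comm _ 2, pow_mul] at h2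
    calc m (n + 2) ≤ K * ENNReal.ofReal (((1 / 2) ^ 2) ^ (n + 2)) := h2
      _ = K * ENNReal.ofReal ((1 / 4) ^ (n + 2)) := by norm_num
      _ ≤ _ := by
        gcongr
        rw [add_assoc]
        exact le_self_add

/-- An increment is a difference of two remainders, so the `n`-th term has integral of order `2ⁿ ·
4⁻ⁿ = 2⁻ⁿ`. -/
theorem IsFastSubsequence.lintegral_sqVariation_lt_top (hφ : IsFastSubsequence i μ e φ)
    (hW : IsAbstractWienerSpace i μ) : ∫⁻ z, sqVariation i e φ z ∂μ < ∞ := by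
  obtain ⟨K, hK, hKn⟩ := hφ.exists_lintegral_remainder_le hW
  have hterm : ∀ n, ∫⁻ z, ENNReal.ofReal ((2 : ℝ) ^ n * ‖increment i e φ n z‖ ^ 2) ∂μ
      ≤ 4 * K * ENNReal.ofReal ((1 / 2) ^ n) := by
    intro n
    have hpt : ∀ z, ENNReal.ofReal ((2 : ℝ) ^ n * ‖increment i e φ n z‖ ^ 2) ≤
        2 * ENNReal.ofReal ((2 : ℝ) ^ n) *
          (ENNReal.ofReal (‖remainder i e (φ n) z‖ ^ 2) +
            ENNReal.ofReal (‖remainder i e (φ (n + 1)) z‖ ^ 2)) := by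
      intro z
      have h1 : increment i e φ n z = remainder i e (φ n) z + -remainder i e (φ (n + 1)) z := by
        simp only [increment, remainder_apply, sub_apply, ContinuousLinearMap.comp_apply]
        abel
      rw [h1]
      refine (ofReal_mul_norm_add_sq_le (by positivity) _ _).trans_eq ?_
      rw [norm_neg, ENNReal.ofReal_mul (by positivity), ENNReal.ofReal_mul (by positivity)]
      ring
    calc _ ≤ _ := lintegral_mono hpt
      _ = 2 * ENNReal.ofReal ((2 : ℝ) ^ n) *
          (∫⁻ z, ENNReal.ofReal (‖remainder i e (φ n) z‖ ^ 2) ∂μ +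
            ∫⁻ z, ENNReal.ofReal (‖remainder i e (φ (n + 1)) z‖ ^ 2) ∂μ) := by
        rw [lintegral_const_mul' _ _ (by finiteness), lintegral_add_left (by fun_prop)]
      _ ≤ 2 * ENNReal.ofReal ((2 : ℝ) ^ n) *
          (K * ENNReal.ofReal ((1 / 4) ^ n) + K * ENNReal.ofReal ((1 / 4) ^ n)) := by
        refine mul_le_mul_right (add_le_add (hKn n) ((hKn (n + 1)).trans ?_)) _
        exact mul_le_mul_right (ENNReal.ofReal_le_ofReal
          (pow_le_pow_of_le_one (by norm_num) (by norm_num) (Nat.le_succ n))) _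
      _ = 4 * K * (ENNReal.ofReal ((2 : ℝ) ^ n) * ENNReal.ofReal ((1 / 4) ^ n)) := by ring
      _ = _ := by
        rw [← ENNReal.ofReal_mul (by positivity), ← mul_pow]
        norm_num
  unfold sqVariation
  rw [lintegral_tsum fun n => by fun_prop]
  refine (ENNReal.tsum_le_tsum hterm).trans_lt ?_
  rw [ENNReal.tsum_mul_left]
  have := (Summable.tsum_ofReal_ne_top
    (summable_geometric_of_lt_one (r := (1 / 2 : ℝ)) (by norm_num) (by norm_num)))
  finiteness

omit [SecondCountableTopology E] [CompleteSpace E] in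
-- The square is a double series; each `e n` is standard Gaussian under `μ`, so all mixed moments
-- are at most `2c`, and the weights are summable.
theorem IsAbstractWienerSpace.lintegral_coordNorm_sq_lt_top (hW : IsAbstractWienerSpace i μ)
    (he : Orthonormal ℝ fun n => dualToH i (e n)) : ∫⁻ z, coordNorm e z ^ 2 ∂μ < ∞ := by
  set c : ℝ≥0∞ := ∫⁻ x, ENNReal.ofReal (x ^ 2) ∂(gaussianReal 0 1) with hc
  have hct : c ≠ ∞ := by
    have h := (memLp_id_gaussianReal (μ := 0) (v := 1) 2).integrable_sq
    exact h.lintegral_lt_top.ne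
  have hec : ∀ n, ∫⁻ z, ENNReal.ofReal (e n z ^ 2) ∂μ = c := by
    intro n
    have h1 : ‖(e n).comp i‖₊ = 1 := by
      ext
      rw [coe_nnnorm, ← norm_dualToH, he.1 n, NNReal.coe_one]
    have h2 := hW.gaussian (e n)
    rw [h1, one_pow] at h2
    rw [hc, ← h2, lintegral_map (by fun_prop) (by fun_prop)]
  have hexp : ∀ z, coordNorm e z ^ 2 = ∑' n, ∑' m,
      ENNReal.ofReal (weight n * |e n z|) * ENNReal.ofReal (weight m * |e m z|) := by
    intro z
    simp_rw [ENNReal.tsum_mul_left, ENNReal.tsum_mul_right]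
    rw [sq]
    rfl
  have hterm : ∀ n m, ∫⁻ z, ENNReal.ofReal (weight n * |e n z|) *
      ENNReal.ofReal (weight m * |e m z|) ∂μ
      ≤ ENNReal.ofReal (weight n) * (ENNReal.ofReal (weight m) * (c + c)) := by
    intro n m
    have hpt : ∀ z, ENNReal.ofReal (weight n * |e n z|) * ENNReal.ofReal (weight m * |e m z|) ≤
        ENNReal.ofReal (weight n * weight m) *
          (ENNReal.ofReal (e n z ^ 2) + ENNReal.ofReal (e m z ^ 2)) := by
      intro z
      have hn := weight_pos n
      have hm := weight_pos m
      rw [← ENNReal.ofReal_mul (by positivity), ← ENNReal.ofReal_add (by positivity)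
        (by positivity), ← ENNReal.ofReal_mul (by positivity)]
      refine ENNReal.ofReal_le_ofReal ?_
      have h : |e n z| * |e m z| ≤ e n z ^ 2 + e m z ^ 2 := by
        rw [← sq_abs (e n z), ← sq_abs (e m z)]
        nlinarith [sq_nonneg (|e n z| - |e m z|), sq_nonneg (|e n z|), sq_nonneg (|e m z|)]
      calc weight n * |e n z| * (weight m * |e m z|)
          = weight n * weight m * (|e n z| * |e m z|) := by ring
        _ ≤ _ := by gcongr
    calc _ ≤ _ := lintegral_mono hpt
      _ = ENNReal.ofReal (weight n * weight m) * (c + c) := by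
        rw [lintegral_const_mul' _ _ (by finiteness), lintegral_add_left (by fun_prop), hec, hec]
      _ = _ := by rw [ENNReal.ofReal_mul (weight_pos n).le, mul_assoc]
  simp_rw [hexp]
  rw [lintegral_tsum fun n => by fun_prop]
  calc _ ≤ ∑' n, ∑' m, ENNReal.ofReal (weight n) * (ENNReal.ofReal (weight m) * (c + c)) := by
        refine ENNReal.tsum_le_tsum fun n => ?_
        rw [lintegral_tsum fun m => by fun_prop]
        exact ENNReal.tsum_le_tsum fun m => hterm n m
    _ = (∑' n, ENNReal.ofReal (weight n)) * ((∑' n, ENNReal.ofReal (weight n)) * (c + c)) := by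
      simp_rw [ENNReal.tsum_mul_left, ENNReal.tsum_mul_right]
    _ < ∞ := by
      have := tsum_weight_ne_top
      finiteness

theorem IsFastSubsequence.lintegral_sqNorm_lt_top (hφ : IsFastSubsequence i μ e φ)
    (hW : IsAbstractWienerSpace i μ) (he : Orthonormal ℝ fun n => dualToH i (e n)) :
    ∫⁻ z, sqNorm i e φ z ∂μ < ∞ := by
  unfold sqNorm
  rw [lintegral_add_left (by unfold sqVariation; fun_prop)]
  exact ENNReal.add_lt_top.mpr ⟨hφ.lintegral_sqVariation_lt_top hW,
    hW.lintegral_coordNorm_sq_lt_top he⟩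

end SqNorm

/-! ### Integral lemmas: Fatou, Laplace transforms, monotone convergence. -/

theorem lowerSemicontinuous_lintegral {X Y : Type*} [TopologicalSpace X] [FirstCountableTopology X]
    [MeasurableSpace Y] {ν : Measure Y} {F : X → Y → ℝ≥0∞} (hm : ∀ x, Measurable (F x))
    (hF : ∀ y, LowerSemicontinuous fun x => F x y) :
    LowerSemicontinuous fun x => ∫⁻ y, F x y ∂ν := by
  rw [lowerSemicontinuous_iff_le_liminf]
  intro x
  exact (lintegral_mono fun y => (hF y).le_liminf x).trans (lintegral_liminf_le hm)

theorem lintegral_Ioi_add (F : ℝ → ℝ≥0∞) (s : ℝ) :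
    ∫⁻ t in Set.Ioi 0, F (s + t) = ∫⁻ r in Set.Ioi s, F r := by
  rw [← lintegral_indicator measurableSet_Ioi, ← lintegral_indicator measurableSet_Ioi,
    ← lintegral_add_left_eq_self (μ := volume) ((Set.Ioi s).indicator F) s]
  congr 1
  funext t
  simp [Set.indicator]

theorem lintegral_Ioo_exp {α : ℝ} (hα : 0 < α) {r : ℝ} (hr : 0 < r) :
    ENNReal.ofReal α * ∫⁻ s in Set.Ioo 0 r, ENNReal.ofReal (Real.exp (-α * s))
      = ENNReal.ofReal (1 - Real.exp (-α * r)) := by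
  have hcont : Continuous fun s : ℝ => Real.exp (-α * s) := by fun_prop
  rw [restrict_Ioo_eq_restrict_Ioc, ← ofReal_integral_eq_lintegral_ofReal
    (hcont.integrableOn_Ioc) (ae_of_all _ fun s => (Real.exp_pos _).le),
    ← intervalIntegral.integral_of_le hr.le, ← ENNReal.ofReal_mul hα.le]
  congr 1
  rw [intervalIntegral.integral_comp_mul_left (fun x => Real.exp x) (neg_ne_zero.mpr hα.ne'),
    integral_exp]
  simp
  field_simp
  ring

/-- The Laplace transform of a tail integral. -/
theorem lintegral_exp_mul_tail {α : ℝ} (hα : 0 < α) {F : ℝ → ℝ≥0∞} (hF : Measurable F) :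
    ENNReal.ofReal α * ∫⁻ s in Set.Ioi 0, ENNReal.ofReal (Real.exp (-α * s)) *
        ∫⁻ r in Set.Ioi s, F r
      = ∫⁻ r in Set.Ioi 0, ENNReal.ofReal (1 - Real.exp (-α * r)) * F r := by
  -- The integrand on the wedge `0 < s < r`, to which Tonelli applies.
  let G : ℝ → ℝ → ℝ≥0∞ := fun s r =>
    {p : ℝ × ℝ | 0 < p.1 ∧ p.1 < p.2}.indicator
      (fun p => ENNReal.ofReal (Real.exp (-α * p.1)) * F p.2) (s, r)
  have hset : MeasurableSet {p : ℝ × ℝ | 0 < p.1 ∧ p.1 < p.2} :=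
    (measurableSet_lt measurable_const measurable_fst).inter
      (measurableSet_lt measurable_fst measurable_snd)
  have hG : Measurable (Function.uncurry G) := Measurable.indicator (by fun_prop) hset
  have h1 : ∫⁻ s in Set.Ioi 0, ENNReal.ofReal (Real.exp (-α * s)) * ∫⁻ r in Set.Ioi s, F r
      = ∫⁻ s, ∫⁻ r, G s r := by
    rw [← lintegral_indicator measurableSet_Ioi]
    refine lintegral_congr fun s => ?_
    by_cases hs : 0 < s
    · rw [Set.indicator_of_mem (Set.mem_Ioi.mpr hs), ← lintegral_const_mul _ hF,
        ← lintegral_indicator measurableSet_Ioi]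
      refine lintegral_congr fun r => ?_
      simp [G, Set.indicator, hs]
    · rw [Set.indicator_of_notMem (by simpa using hs)]
      simp [G, hs]
  have h2 : ENNReal.ofReal α * ∫⁻ r, ∫⁻ s, G s r
      = ∫⁻ r in Set.Ioi 0, ENNReal.ofReal (1 - Real.exp (-α * r)) * F r := by
    have hGr : Measurable fun r => ∫⁻ s, G s r := hG.lintegral_prod_left'
    rw [← lintegral_const_mul _ hGr, ← lintegral_indicator measurableSet_Ioi]
    refine lintegral_congr fun r => ?_
    by_cases hr : 0 < r
    · rw [Set.indicator_of_mem (Set.mem_Ioi.mpr hr), ← lintegral_Ioo_exp hα hr, mul_assoc,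
        ← lintegral_mul_const _ (by fun_prop), ← lintegral_indicator measurableSet_Ioo]
      congr 1
    · rw [Set.indicator_of_notMem (by simpa using hr)]
      have : ∀ s, G s r = 0 := fun s => by
        refine Set.indicator_of_notMem ?_ _
        rintro ⟨hs1, hs2⟩
        exact hr (hs1.trans hs2)
      simp [this]
  rw [h1, lintegral_lintegral_swap hG.aemeasurable, h2]

theorem tendsto_lintegral_one_sub_exp {F : ℝ → ℝ≥0∞} (hF : Measurable F) :
    Tendsto (fun α : ℝ => ∫⁻ t in Set.Ioi 0, ENNReal.ofReal (1 - Real.exp (-α * t)) * F t) atTop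
      (𝓝 (∫⁻ t in Set.Ioi 0, F t)) := by
  have hle : ∀ {a b t : ℝ}, a ≤ b → 0 < t →
      ENNReal.ofReal (1 - Real.exp (-a * t)) * F t ≤
        ENNReal.ofReal (1 - Real.exp (-b * t)) * F t := by
    intro a b t hab ht
    refine mul_le_mul_left (ENNReal.ofReal_le_ofReal (sub_le_sub_left ?_ 1)) _
    exact Real.exp_le_exp.mpr (mul_le_mul_of_nonneg_right (neg_le_neg hab) ht.le)
  have hmono : Monotone fun α : ℝ =>
      ∫⁻ t in Set.Ioi 0, ENNReal.ofReal (1 - Real.exp (-α * t)) * F t := fun a b hab =>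
    setLIntegral_mono' measurableSet_Ioi fun t ht => hle hab ht
  have hseq : Tendsto (fun n : ℕ =>
      ∫⁻ t in Set.Ioi 0, ENNReal.ofReal (1 - Real.exp (-(n : ℝ) * t)) * F t) atTop
      (𝓝 (∫⁻ t in Set.Ioi 0, F t)) := by
    refine lintegral_tendsto_of_tendsto_of_monotone
      (fun n => (Measurable.mul (by fun_prop) hF).aemeasurable) ?_ ?_
    · exact (ae_restrict_mem measurableSet_Ioi).mono fun t ht a b hab =>
        hle (Nat.cast_le.mpr hab) ht
    · refine (ae_restrict_mem measurableSet_Ioi).mono fun t (ht : 0 < t) => ?_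
      have h1 : Tendsto (fun n : ℕ => Real.exp (-(n : ℝ) * t)) atTop (𝓝 0) := by
        refine Real.tendsto_exp_atBot.comp ?_
        simp only [neg_mul]
        exact tendsto_neg_atTop_atBot.comp (tendsto_natCast_atTop_atTop.atTop_mul_const ht)
      have h2 := ENNReal.tendsto_ofReal (h1.const_sub 1)
      rw [sub_zero, ENNReal.ofReal_one] at h2
      have h3 := ENNReal.Tendsto.mul_const (b := F t) h2 (Or.inl one_ne_zero)
      rwa [one_mul] at h3
  -- Monotonicity in the real parameter provides a limit; monotone convergence along the integers
  -- identifies it.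
  have hlim := tendsto_atTop_iSup hmono
  rwa [tendsto_nhds_unique (hlim.comp tendsto_natCast_atTop_atTop) hseq] at hlim

/-! ### The Brownian semigroup, its resolvent, and excessive functions. -/

section Semigroup

variable {E : Type*} [NormedAddCommGroup E] [NormedSpace ℝ E] [MeasurableSpace E] [BorelSpace E]
  [SecondCountableTopology E] {μ : Measure E} {f : E → ℝ≥0∞}

omit [SecondCountableTopology E] in
theorem semigroup_eq (hf : Measurable f) (t : ℝ) (y : E) :
    semigroup μ t f y = ∫⁻ w, f (y + √t • w) ∂μ := by
  rw [semigroup, scaledMeasure, lintegral_map (by fun_prop) (by fun_prop)]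

omit [BorelSpace E] [SecondCountableTopology E] in
theorem semigroup_translate (t : ℝ) (f : E → ℝ≥0∞) (z y : E) :
    semigroup μ t (fun w => f (w - z)) y = semigroup μ t f (y - z) := by
  simp only [semigroup, add_sub_right_comm]

omit [BorelSpace E] [SecondCountableTopology E] in
theorem resolvent_translate (α : ℝ) (f : E → ℝ≥0∞) (z y : E) :
    resolvent μ α (fun w => f (w - z)) y = resolvent μ α f (y - z) := by
  simp only [resolvent, semigroup_translate]

theorem measurable_semigroup [SFinite μ] (hf : Measurable f) :
    Measurable fun p : ℝ × E => semigroup μ p.1 f p.2 := by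
  simp only [semigroup_eq hf]
  refine Measurable.lintegral_prod_right' (f := fun q : (ℝ × E) × E =>
    f (q.1.2 + √q.1.1 • q.2)) ?_
  fun_prop

theorem measurable_resolvent [SFinite μ] (hf : Measurable f) (α : ℝ) :
    Measurable (resolvent μ α f) := by
  have h := measurable_semigroup (μ := μ) hf
  refine Measurable.lintegral_prod_right' (f := fun q : E × ℝ =>
    ENNReal.ofReal (Real.exp (-α * q.2)) * semigroup μ q.2 f q.1) ?_
  exact Measurable.mul (by fun_prop) (h.comp measurable_swap)

theorem measurable_semigroup_left [SFinite μ] (hf : Measurable f) (y : E) :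
    Measurable fun t : ℝ => semigroup μ t f y :=
  (measurable_semigroup hf).comp measurable_prodMk_right

omit [SecondCountableTopology E] in
theorem lowerSemicontinuous_semigroup (hf : LowerSemicontinuous f) (t : ℝ) :
    LowerSemicontinuous (semigroup μ t f) :=
  lowerSemicontinuous_lintegral
    (fun y => hf.measurable.comp (by fun_prop))
    fun w y a ha => ((continuous_add_const w).tendsto y).eventually (hf (y + w) a ha)

theorem lowerSemicontinuous_resolvent [SFinite μ] (hf : LowerSemicontinuous f) (α : ℝ) :
    LowerSemicontinuous (resolvent μ α f) := by
  refine lowerSemicontinuous_lintegral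
    (fun y => Measurable.mul (by fun_prop) (measurable_semigroup_left hf.measurable y)) fun t => ?_
  exact (ENNReal.continuous_const_mul ENNReal.ofReal_ne_top).comp_lowerSemicontinuous
    (lowerSemicontinuous_semigroup hf t) fun a b h => mul_le_mul_right h _

variable {H : Type*} [NormedAddCommGroup H] [InnerProductSpace ℝ H] {i : H →L[ℝ] E}
  [CompleteSpace E]

theorem IsAbstractWienerSpace.semigroup_semigroup (hW : IsAbstractWienerSpace i μ)
    (hf : Measurable f) {s t : ℝ} (hs : 0 ≤ s) (ht : 0 ≤ t) (y : E) :
    semigroup μ s (semigroup μ t f) y = semigroup μ (s + t) f y := by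
  have := hW.isProbabilityMeasure
  have hm : Measurable (semigroup μ t f) := (measurable_semigroup hf).comp measurable_prodMk_left
  rw [semigroup_eq hm]
  simp only [semigroup_eq hf]
  have h := congrArg (fun ν => ∫⁻ w, f (y + w) ∂ν) (hW.map_sqrt_add hs ht)
  rw [lintegral_map (by fun_prop) (by fun_prop), lintegral_map (by fun_prop) (by fun_prop),
    lintegral_prod _ (by fun_prop)] at h
  simpa only [add_assoc] using h

/-- The resolvent equation `α U_{β+α} U_β f = U_β f - U_{β+α} f`, written without subtraction so
that it makes sense for infinite values. -/
theorem IsAbstractWienerSpace.mul_resolvent_resolvent (hW : IsAbstractWienerSpace i μ)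
    (hf : Measurable f) (β : ℝ) {α : ℝ} (hα : 0 < α) (y : E) :
    ENNReal.ofReal α * resolvent μ (β + α) (resolvent μ β f) y =
      ∫⁻ t in Set.Ioi 0, ENNReal.ofReal (1 - Real.exp (-α * t)) *
        (ENNReal.ofReal (Real.exp (-β * t)) * semigroup μ t f y) := by
  have := hW.isProbabilityMeasure
  have hF : Measurable fun t : ℝ => ENNReal.ofReal (Real.exp (-β * t)) * semigroup μ t f y :=
    Measurable.mul (by fun_prop) (measurable_semigroup_left hf y)
  rw [← lintegral_exp_mul_tail hα hF]
  congr 1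
  refine setLIntegral_congr_fun measurableSet_Ioi fun s (hs : 0 < s) => ?_
  have hsplit : ENNReal.ofReal (Real.exp (-(β + α) * s)) =
      ENNReal.ofReal (Real.exp (-α * s)) * ENNReal.ofReal (Real.exp (-β * s)) := by
    rw [← ENNReal.ofReal_mul (Real.exp_pos _).le, ← Real.exp_add]
    congr 2
    ring
  have hmeas : Measurable fun p : E × ℝ =>
      ENNReal.ofReal (Real.exp (-β * p.2)) * semigroup μ p.2 f (y + √s • p.1) := by
    refine Measurable.mul (by fun_prop) ?_
    exact (measurable_semigroup (μ := μ) hf).comp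
      (g := fun p : ℝ × E => semigroup μ p.1 f p.2)
      (f := fun p : E × ℝ => (p.2, y + √s • p.1)) (by fun_prop)
  -- By the semigroup property `e^{-βs} P_s U_β f` is the tail from `s` on of the integral defining
  -- `U_β f`.
  have hkey : ENNReal.ofReal (Real.exp (-β * s)) * semigroup μ s (resolvent μ β f) y =
      ∫⁻ r in Set.Ioi s, ENNReal.ofReal (Real.exp (-β * r)) * semigroup μ r f y := by
    rw [← lintegral_Ioi_add, semigroup_eq (measurable_resolvent hf β)]
    simp only [resolvent]
    rw [lintegral_lintegral_swap hmeas.aemeasurable,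
      ← lintegral_const_mul _ (Measurable.lintegral_prod_left' hmeas)]
    refine setLIntegral_congr_fun measurableSet_Ioi fun t (ht : 0 < t) => ?_
    have hm : Measurable (semigroup μ t f) := (measurable_semigroup hf).comp measurable_prodMk_left
    simp only
    rw [lintegral_const_mul _ (by fun_prop), ← semigroup_eq hm,
      hW.semigroup_semigroup hf hs.le ht.le, ← mul_assoc,
      ← ENNReal.ofReal_mul (Real.exp_pos _).le, ← Real.exp_add]
    congr 3
    ring
  rw [hsplit, mul_assoc, hkey]

/-- Potentials `U_β f` are `β`-excessive. -/
theorem IsAbstractWienerSpace.isExcessive_resolvent (hW : IsAbstractWienerSpace i μ)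
    (hf : Measurable f) (β : ℝ) : IsExcessive μ β (resolvent μ β f) := by
  have := hW.isProbabilityMeasure
  refine ⟨measurable_resolvent hf β, fun α hα y => ?_, fun y => ?_⟩
  · rw [hW.mul_resolvent_resolvent hf β hα]
    refine lintegral_mono fun t => mul_le_of_le_one_left bot_le ?_
    rw [ENNReal.ofReal_le_one]
    linarith [Real.exp_pos (-α * t)]
  · have hF : Measurable fun t : ℝ => ENNReal.ofReal (Real.exp (-β * t)) * semigroup μ t f y :=
      Measurable.mul (by fun_prop) (measurable_semigroup_left hf y)
    refine (tendsto_lintegral_one_sub_exp hF).congr' ?_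
    filter_upwards [eventually_gt_atTop 0] with α hα
    rw [hW.mul_resolvent_resolvent hf β hα]

omit [SecondCountableTopology E] [CompleteSpace E] in
theorem IsExcessive.translate {u : E → ℝ≥0∞} {β : ℝ} (hu : IsExcessive μ β u) (z : E) :
    IsExcessive μ β fun y => u (y - z) where
  measurable := hu.measurable.comp (measurable_id.sub_const z)
  le α hα y := by
    rw [resolvent_translate]
    exact hu.le α hα (y - z)
  tendsto y := by
    simp only [resolvent_translate]
    exact hu.tendsto (y - z)

end Semigroup

/-! ### The potential `U_1 q²`: comparison with `q²`, compactness, invariance. -/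

theorem lintegral_exp_neg : ∫⁻ t in Set.Ioi (0 : ℝ), ENNReal.ofReal (Real.exp (-1 * t)) = 1 := by
  rw [← ofReal_integral_eq_lintegral_ofReal]
  · simp only [neg_mul, one_mul]
    rw [integral_exp_neg_Ioi_zero, ENNReal.ofReal_one]
  · simpa [IntegrableOn] using integrableOn_exp_neg_Ioi 0
  · exact ae_of_all _ fun t => (Real.exp_pos _).le

theorem lintegral_mul_exp_neg_lt_top :
    ∫⁻ t in Set.Ioi (0 : ℝ), ENNReal.ofReal (Real.exp (-1 * t)) * ENNReal.ofReal t < ∞ := by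
  -- The integral is `Γ(2)`.
  have h := Real.GammaIntegral_convergent (s := 2) two_pos
  refine lt_of_eq_of_lt ?_ h.lintegral_lt_top
  refine lintegral_congr fun t => ?_
  rw [← ENNReal.ofReal_mul (Real.exp_pos _).le]
  norm_num

section Lyapunov

variable {E H : Type*} [NormedAddCommGroup H] [InnerProductSpace ℝ H] [CompleteSpace H]
  [NormedAddCommGroup E] [NormedSpace ℝ E] [CompleteSpace E] [SecondCountableTopology E]
  [MeasurableSpace E] [BorelSpace E] {i : H →L[ℝ] E} {μ : Measure E}
  {e : ℕ → StrongDual ℝ E} {φ : ℕ → ℕ}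

omit [CompleteSpace E] [SecondCountableTopology E] [MeasurableSpace E] [BorelSpace E] in
-- Midpoint inequality, from `2y = (y + w) + (y - w)`: homogeneity puts `4` on the left, and one
-- factor `2` cancels.
theorem sqNorm_le_half_add (y w : E) :
    2 * sqNorm i e φ y ≤ sqNorm i e φ (y + w) + sqNorm i e φ (y - w) := by
  have h1 := sqNorm_add_le (i := i) (e := e) (φ := φ) (y + w) (y - w)
  have h2 : y + w + (y - w) = (2 : ℝ) • y := by module
  rw [h2, sqNorm_smul, ← mul_add] at h1
  have h3 : ENNReal.ofReal (2 ^ 2) = 2 * 2 := by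
    rw [ENNReal.ofReal_pow zero_le_two, sq]
    simp
  rw [h3, mul_assoc] at h1
  exact (ENNReal.mul_le_mul_iff_right two_ne_zero ENNReal.ofNat_ne_top).mp h1

/-- `q²` is subharmonic. -/
theorem IsAbstractWienerSpace.sqNorm_le_semigroup (hW : IsAbstractWienerSpace i μ) (t : ℝ)
    (y : E) : sqNorm i e φ y ≤ semigroup μ t (sqNorm i e φ) y := by
  have := hW.isProbabilityMeasure
  have hm : Measurable (sqNorm i e φ) := lowerSemicontinuous_sqNorm.measurable
  have hneg : ∫⁻ w, sqNorm i e φ (y - √t • w) ∂μ = semigroup μ t (sqNorm i e φ) y := by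
    rw [semigroup_eq hm]
    conv_rhs => rw [← hW.map_neg, lintegral_map (by fun_prop) (by fun_prop)]
    simp only [smul_neg, ← sub_eq_add_neg]
  have h : 2 * sqNorm i e φ y ≤ 2 * semigroup μ t (sqNorm i e φ) y := by
    calc 2 * sqNorm i e φ y = ∫⁻ _, 2 * sqNorm i e φ y ∂μ := by simp
      _ ≤ ∫⁻ w, (sqNorm i e φ (y + √t • w) + sqNorm i e φ (y - √t • w)) ∂μ :=
        lintegral_mono fun w => sqNorm_le_half_add y _
      _ = 2 * semigroup μ t (sqNorm i e φ) y := by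
        rw [lintegral_add_left (by fun_prop), hneg, ← semigroup_eq hm, two_mul]
  exact (ENNReal.mul_le_mul_iff_right two_ne_zero ENNReal.ofNat_ne_top).mp h

/-- `e^{-t} dt` has total mass one, so subharmonicity survives averaging over `t`. -/
theorem IsAbstractWienerSpace.sqNorm_le_resolvent (hW : IsAbstractWienerSpace i μ) (y : E) :
    sqNorm i e φ y ≤ resolvent μ 1 (sqNorm i e φ) y := by
  calc sqNorm i e φ y
      = ∫⁻ t in Set.Ioi (0 : ℝ), ENNReal.ofReal (Real.exp (-1 * t)) * sqNorm i e φ y := by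
        rw [lintegral_mul_const _ (by fun_prop), lintegral_exp_neg, one_mul]
    _ ≤ resolvent μ 1 (sqNorm i e φ) y :=
        lintegral_mono fun t => mul_le_mul_right (hW.sqNorm_le_semigroup t y) _

omit [SecondCountableTopology E] [CompleteSpace E] in
-- By the scaling of `q²`, `P_t q²(y)` grows at most linearly in `t`, which `e^{-t}` integrates.
theorem IsAbstractWienerSpace.resolvent_sqNorm_lt_top (hW : IsAbstractWienerSpace i μ)
    (hint : ∫⁻ z, sqNorm i e φ z ∂μ < ∞) {y : E} (hy : sqNorm i e φ y < ∞) :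
    resolvent μ 1 (sqNorm i e φ) y < ∞ := by
  have := hW.isProbabilityMeasure
  have hm : Measurable (sqNorm i e φ) := lowerSemicontinuous_sqNorm.measurable
  set c := ∫⁻ z, sqNorm i e φ z ∂μ with hc
  have hP : ∀ t : ℝ, 0 < t → semigroup μ t (sqNorm i e φ) y ≤
      2 * sqNorm i e φ y + ENNReal.ofReal t * (2 * c) := by
    intro t ht
    rw [semigroup_eq hm]
    calc ∫⁻ w, sqNorm i e φ (y + √t • w) ∂μ
        ≤ ∫⁻ w, (2 * sqNorm i e φ y + 2 * ENNReal.ofReal t * sqNorm i e φ w) ∂μ := by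
          refine lintegral_mono fun w => (sqNorm_add_le _ _).trans_eq ?_
          rw [sqNorm_smul, Real.sq_sqrt ht.le, mul_assoc]
      _ = _ := by
        rw [lintegral_add_left (by fun_prop), lintegral_const_mul _ hm, lintegral_const,
          measure_univ, mul_one, ← hc]
        ring
  have hexp := lintegral_mul_exp_neg_lt_top
  calc resolvent μ 1 (sqNorm i e φ) y
      ≤ ∫⁻ t in Set.Ioi (0 : ℝ), (ENNReal.ofReal (Real.exp (-1 * t)) * (2 * sqNorm i e φ y) +
        ENNReal.ofReal (Real.exp (-1 * t)) * ENNReal.ofReal t * (2 * c)) := by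
        refine setLIntegral_mono' measurableSet_Ioi fun t ht => ?_
        rw [mul_assoc, ← mul_add]
        exact mul_le_mul_right (hP t ht) _
    _ = 2 * sqNorm i e φ y +
        (∫⁻ t in Set.Ioi (0 : ℝ), ENNReal.ofReal (Real.exp (-1 * t)) * ENNReal.ofReal t) *
          (2 * c) := by
        rw [lintegral_add_left (by fun_prop), lintegral_mul_const _ (by fun_prop),
          lintegral_exp_neg, one_mul, lintegral_mul_const _ (by fun_prop)]
    _ < ∞ := by finiteness

omit [SecondCountableTopology E] [CompleteSpace E] [MeasurableSpace E] [BorelSpace E] in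
theorem mem_image_add_finiteSet {y z : E} :
    y ∈ (fun y => y + z) '' finiteSet i e φ ↔ sqNorm i e φ (y - z) < ∞ := by
  rw [← mem_finiteSet]
  constructor
  · rintro ⟨w, hw, rfl⟩
    simpa using hw
  · exact fun h => ⟨y - z, h, sub_add_cancel y z⟩

omit [CompleteSpace E] [SecondCountableTopology E] [BorelSpace E] in
theorem lyapunov_apply (z y : E) :
    lyapunov i μ e φ z y = resolvent μ 1 (sqNorm i e φ) (y - z) := by
  simp only [lyapunov, qNorm_sq]

theorem IsAbstractWienerSpace.isCompact_lyapunov_le (hW : IsAbstractWienerSpace i μ)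
    (he : Orthonormal ℝ fun n => dualToH i (e n))
    (hsep : ∀ y z : E, (∀ n, e n y = e n z) → y = z) (hφ : StrictMono φ) (z : E) (a : ℝ≥0) :
    IsCompact {y | lyapunov i μ e φ z y ≤ a} := by
  have := hW.isProbabilityMeasure
  have h0 : IsCompact {y | resolvent μ 1 (sqNorm i e φ) y ≤ a} := by
    refine (isCompact_sqNorm_le he hsep hφ a).of_isClosed_subset ?_ fun y hy =>
      (hW.sqNorm_le_resolvent y).trans hy
    exact (lowerSemicontinuous_resolvent lowerSemicontinuous_sqNorm 1).isClosed_preimage _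
  convert! h0.image (continuous_add_const z) using 1
  ext y
  simp only [lyapunov_apply, Set.mem_ofPred_eq, Set.mem_image]
  constructor
  · exact fun h => ⟨y - z, h, sub_add_cancel y z⟩
  · rintro ⟨w, hw, rfl⟩
    simpa using hw

omit [SecondCountableTopology E] [CompleteSpace E] in
-- Integrability puts `μ`-almost every `w` in the linear space `E_x`; translation by `√t w` then
-- preserves both `E_x + z` and its complement.
theorem IsAbstractWienerSpace.isInvariantSet (hW : IsAbstractWienerSpace i μ)
    (hint : ∫⁻ z, sqNorm i e φ z ∂μ < ∞) (z : E) :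
    IsInvariantSet μ ((fun y => y + z) '' finiteSet i e φ) := by
  have := hW.isProbabilityMeasure
  have hm : Measurable (sqNorm i e φ) := lowerSemicontinuous_sqNorm.measurable
  set A := (fun y => y + z) '' finiteSet i e φ with hA
  have hAm : MeasurableSet A := by
    have h : A = {y | sqNorm i e φ (y - z) < ∞} := by
      ext y
      exact mem_image_add_finiteSet
    rw [h]
    exact measurableSet_lt (by fun_prop) measurable_const
  refine ⟨hAm, fun t ht => funext fun y => ?_⟩
  rw [semigroup_eq (measurable_const.indicator hAm)]
  have hae : ∀ᵐ w ∂μ, A.indicator (fun _ => (1 : ℝ≥0∞)) (y + √t • w)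
      = A.indicator (fun _ => (1 : ℝ≥0∞)) y := by
    filter_upwards [ae_lt_top hm hint.ne] with w hw
    have hw' : √t • w ∈ finiteSubmodule i e φ :=
      Submodule.smul_mem _ _ (mem_finiteSubmodule.mpr hw)
    have hiff : y + √t • w ∈ A ↔ y ∈ A := by
      rw [hA, mem_image_add_finiteSet, mem_image_add_finiteSet, ← mem_finiteSubmodule,
        ← mem_finiteSubmodule, add_sub_right_comm]
      exact Submodule.add_mem_iff_left _ hw'
    by_cases hy : y ∈ A
    · rw [Set.indicator_of_mem hy, Set.indicator_of_mem (hiff.mpr hy)]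
    · rw [Set.indicator_of_notMem hy, Set.indicator_of_notMem (mt hiff.mp hy)]
  rw [lintegral_congr_ae hae, lintegral_const, measure_univ, mul_one]

end Lyapunov

end WienerPotential

/-! ### Assembly of the theorem. -/

theorem theorem2p5 {H E : Type*}
    [NormedAddCommGroup H] [InnerProductSpace ℝ H] [CompleteSpace H]
    [TopologicalSpace.SeparableSpace H]
    [NormedAddCommGroup E] [NormedSpace ℝ E] [CompleteSpace E]
    [MeasurableSpace E] [BorelSpace E]
    (i : H →L[ℝ] E) (μ : Measure E) (hW : WienerPotential.IsAbstractWienerSpace i μ)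
    (x : E) (hx : x ∉ Set.range i) :
    -- the data from which `q_x` is built exist
    (∃ e : ℕ → StrongDual ℝ E, WienerPotential.IsAdaptedBasis i x e) ∧
    (∀ e : ℕ → StrongDual ℝ E, WienerPotential.IsAdaptedBasis i x e →
      ∃ φ : ℕ → ℕ, WienerPotential.IsFastSubsequence i μ e φ) ∧
    -- and for every choice of them the theorem holds
    (∀ (e : ℕ → StrongDual ℝ E) (φ : ℕ → ℕ),
      WienerPotential.IsAdaptedBasis i x e →
      WienerPotential.IsFastSubsequence i μ e φ →
      ∀ z : E,
        WienerPotential.IsCompactLyapunov μ 1 (WienerPotential.lyapunov i μ e φ z) ∧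
        (∀ a : ℝ≥0, IsCompact {y | WienerPotential.lyapunov i μ e φ z y ≤ a}) ∧
        {y | WienerPotential.lyapunov i μ e φ z y < ∞} =
          (fun y => y + z) '' WienerPotential.finiteSet i e φ ∧
        (∃ A : AffineSubspace ℝ E,
          (A : Set E) = (fun y => y + z) '' WienerPotential.finiteSet i e φ) ∧
        WienerPotential.IsInvariantSet μ
          ((fun y => y + z) '' WienerPotential.finiteSet i e φ)) := by
  -- `E` inherits separability from the dense image of `H`.
  have hsepE : TopologicalSpace.SeparableSpace E := hW.denseRange.separableSpace i.continuous
  have hsecE : SecondCountableTopology E := UniformSpace.secondCountable_of_separable E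
  refine ⟨WienerPotential.exists_isAdaptedBasis hW.injective hW.denseRange hx,
    fun e he => hW.exists_isFastSubsequence he.orthonormal he.separates, ?_⟩
  intro e φ he hφ z
  have hint := hφ.lintegral_sqNorm_lt_top hW he.orthonormal
  have hm : Measurable (WienerPotential.sqNorm i e φ) :=
    WienerPotential.lowerSemicontinuous_sqNorm.measurable
  have hcompact := hW.isCompact_lyapunov_le he.orthonormal he.separates hφ.strictMono z
  have hlyap : WienerPotential.lyapunov i μ e φ z = fun y =>
      WienerPotential.resolvent μ 1 (WienerPotential.sqNorm i e φ) (y - z) :=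
    funext fun y => WienerPotential.lyapunov_apply z y
  refine ⟨⟨one_pos, ?_, fun a _ => (hcompact a).closure⟩, hcompact, ?_, ?_,
    hW.isInvariantSet hint z⟩
  · rw [hlyap]
    exact (hW.isExcessive_resolvent hm 1).translate z
  · ext y
    rw [WienerPotential.mem_image_add_finiteSet, Set.mem_ofPred_eq, WienerPotential.lyapunov_apply]
    exact ⟨fun h => (hW.sqNorm_le_resolvent _).trans_lt h,
      fun h => hW.resolvent_sqNorm_lt_top hint h⟩
  · refine ⟨AffineSubspace.mk' z (WienerPotential.finiteSubmodule i e φ), ?_⟩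
    ext y
    rw [SetLike.mem_coe, AffineSubspace.mem_mk', vsub_eq_sub, WienerPotential.mem_finiteSubmodule,
      WienerPotential.mem_image_add_finiteSet]
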